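/- Let $m_1,m_2\ge 1$ and $p_1,p_2\ge 0$ be integers (together with integers $k_1,k_2\ge 0$, where $k_i\geq 1$ unless $p_i=0$, they form the parameter $\gamma=(m,k,p)$ of a hollow lattice diagram; the statement does not involve $k$), and set $n=m_1+p_1+m_2+p_2+1$. Let $\mathcal G_\gamma\subset\mathbb C[X_n,Y_n]=\mathbb C[x_1,\dots,x_n,y_1,\dots,y_n]$ be the ideal generated by the monomials $x_iy_i$ ($1\le i\le n$), $\prod_{i\in D}x_i$ ($D\subset\{1,\dots,n\}$, $|D|=m_1+p_1+1$) and $\prod_{i\in E}y_i$ ($E\subset\{1,\dots,n\}$, $|E|=m_2+p_2+1$). Ferrers diagrams are drawn in the French way, and a standard tableau with $n$ cells is a filling of such a diagram by $1,\dots,n$, each used once, that increases along rows (left to right) and columns (bottom to top). For a standard tableau $T$ with $n$ cells let $\pi_T(1)=0$ and, for $1<i\le n$, $\pi_T(i)=\pi_T(i-1)$ if $i$ lies weakly southeast of $i-1$ in $T$, and $\pi_T(i)=\pi_T(i-1)+1$ if $i$ lies weakly northwest of $i-1$. The cocharge diagram $C_\gamma(T)$ is the filling of the shape of $T$ whose entry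 in the cell of $i$ is $(d,0)$ if $d\ge 0$ and $(0,-d)$ if $d<0$, where $d=\pi_T(i)-\pi_T(m_2+p_2+1)$. For a standard tableau $T$ with $n$ cells and a filling $V$ of the shape of $T$ by pairs of natural numbers, put $$[T,V]_{\mathrm{per}}=\sum_{\sigma}\ \prod_{i=1}^n x_{\sigma(i)}^{a_i}\,y_{\sigma(i)}^{b_i},$$ where $(a_i,b_i)$ is the entry of $V$ in the cell that contains $i$ in $T$, and $\sigma$ runs over the permutations of $\{1,\dots,n\}$ that map each row of $T$ to itself. Let $$\mathcal B_\gamma=\{[T,C_\gamma(U)]_{\mathrm{per}} : T,U \text{ standard tableaux with } n \text{ cells and of the same shape}\},$$ and for $b=[T,V]_{\mathrm{per}}\in\mathcal B_\gamma$ let $|X(b)|=\sum_i a_i$ and $|Y(b)|=\sum_i b_i$, which are the degrees of $b$ in the variables $x$ and in the variables $y$. Then the bigraded Hilbert series $\sum_{r,s\ge 0}\dim_{\mathbb C}\bigl((\mathbb C[X_n,Y_n]/\mathcal G_\gamma)_{r,s}\bigr)\,t^rq^s$, where $(\cdot)_{r,s}$ denotes the component of total degree $r$ in the $x_i$ and total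 degree $s$ in the $y_i$, equals $$\frac{1}{(t)_{m_1+p_1}\,(q)_{m_2+p_2}}\sum_{b\in\mathcal B_\gamma}t^{|X(b)|}q^{|Y(b)|},$$ where $(z)_j=(1-z)(1-z^2)\cdots(1-z^j)$. -/

import Mathlib

open MvPolynomial

/-- Parameters `γ = (m, k, p)` of a hollow lattice diagram: `mᵢ ≥ 1`, `pᵢ ≥ 0`, and `kᵢ ≥ 1`,
where `kᵢ = 0` is also allowed if `pᵢ = 0`. -/
structure HollowParam where
  m₁ : ℕ
  m₂ : ℕ
  k₁ : ℕ
  k₂ : ℕ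
  p₁ : ℕ
  p₂ : ℕ
  hm₁ : 1 ≤ m₁
  hm₂ : 1 ≤ m₂
  hk₁ : 1 ≤ k₁ ∨ p₁ = 0
  hk₂ : 1 ≤ k₂ ∨ p₂ = 0

/-- The number of cells of the hollow lattice diagram. -/
abbrev HollowParam.n (γ : HollowParam) : ℕ := γ.m₁ + γ.p₁ + γ.m₂ + γ.p₂ + 1

/-- `ℂ[Xₙ, Yₙ]`: the variable `Sum.inl i` is `x_{i+1}` and `Sum.inr i` is `y_{i+1}`. -/
abbrev PolyXY (n : ℕ) : Type := MvPolynomial (Fin n ⊕ Fin n) ℂ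

/-- The alphabet `𝒜` of pairs `(a, b)` of naturals with `a = 0` or `b = 0`. -/
def Alphabet : Type := {u : ℕ × ℕ // u.1 = 0 ∨ u.2 = 0}

namespace Alphabet

/-- The signed value `a - b` of a letter `(a, b)`. -/
def toInt (u : Alphabet) : ℤ := (u.1.1 : ℤ) - u.1.2

/-- `z ≥ 0` names the letter `(z, 0)` and `z < 0` names the letter `(0, -z)`. -/
def ofInt (z : ℤ) : Alphabet := ⟨(z.toNat, (-z).toNat), by omega⟩

theorem toInt_ofInt (z : ℤ) : toInt (ofInt z) = z := by
  simp only [toInt, ofInt]; omega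

theorem ofInt_toInt (u : Alphabet) : ofInt (toInt u) = u := by
  obtain ⟨⟨a, b⟩, h⟩ := u
  apply Subtype.ext
  simp only [toInt, ofInt, Prod.mk.injEq]
  simp only at h
  omega

theorem toInt_injective : Function.Injective toInt :=
  Function.LeftInverse.injective ofInt_toInt

/-- The order of `𝒜`: `(a₁, b₁) < (a₂, b₂)` iff `a₁ - b₁ < a₂ - b₂`
(distinct letters of `𝒜` have distinct differences). -/
noncomputable instance : LinearOrder Alphabet := LinearOrder.lift' toInt toInt_injective

/-- The order on `ℕ × ℕ` by difference, ties being broken by the first entry, restricts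
to the order of `𝒜`. -/
theorem lt_iff (u v : Alphabet) :
    u < v ↔ (u.1.1 : ℤ) - u.1.2 < (v.1.1 : ℤ) - v.1.2 ∨
      ((u.1.1 : ℤ) - u.1.2 = (v.1.1 : ℤ) - v.1.2 ∧ u.1.1 < v.1.1) := by
  have h : u < v ↔ (u.1.1 : ℤ) - u.1.2 < (v.1.1 : ℤ) - v.1.2 := Iff.rfl
  obtain ⟨⟨a, b⟩, hu⟩ := u
  obtain ⟨⟨c, d⟩, hv⟩ := v
  rw [h]
  simp only at hu hv ⊢
  omega

/-- `𝒜` is ordered like the integers. -/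
noncomputable def orderIsoInt : Alphabet ≃o ℤ where
  toFun := toInt
  invFun := ofInt
  left_inv := ofInt_toInt
  right_inv := toInt_ofInt
  map_rel_iff' := Iff.rfl

end Alphabet

/-- The map `h : ℕ → 𝒜` that preserves order and covers and sends `j₀` to `(0, 0)`. -/
def shiftMap (j₀ j : ℕ) : Alphabet := Alphabet.ofInt ((j : ℤ) - j₀)

/-- `shiftMap j₀` is the unique map that preserves order and covers and sends `j₀` to `(0, 0)`. -/
theorem shiftMap_unique (j₀ : ℕ) (h : ℕ → Alphabet) :
    (StrictMono h ∧ (∀ i j, i ⋖ j → h i ⋖ h j) ∧ (h j₀).1 = (0, 0)) ↔ h = shiftMap j₀ := by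
  have key : ∀ u v : Alphabet, u ⋖ v ↔ u.toInt + 1 = v.toInt := fun u v => by
    rw [← apply_covBy_apply_iff Alphabet.orderIsoInt, Order.covBy_iff_add_one_eq]; rfl
  constructor
  · rintro ⟨-, hc, h0⟩
    have h1 : ∀ i, (h i).toInt + 1 = (h (i + 1)).toInt := fun i =>
      (key _ _).1 (hc i (i + 1) (Order.covBy_add_one i))
    have h2 : ∀ i : ℕ, (h i).toInt = (h 0).toInt + i := by
      intro i
      induction i with
      | zero => simp
      | succ i ih => rw [← h1, ih]; push_cast; ring
    have h3 : (h j₀).toInt = 0 := by simp [Alphabet.toInt, h0]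
    funext j
    apply Alphabet.toInt_injective
    rw [shiftMap, Alphabet.toInt_ofInt]
    have := h2 j
    have := h2 j₀
    omega
  · rintro rfl
    refine ⟨fun i j hij => ?_, fun i j hij => ?_, ?_⟩
    · change Alphabet.toInt _ < Alphabet.toInt _
      simp only [shiftMap, Alphabet.toInt_ofInt]; omega
    · rw [key]
      simp only [shiftMap, Alphabet.toInt_ofInt]
      have := Order.covBy_iff_add_one_eq.1 hij
      omega
    · simp [shiftMap, Alphabet.ofInt]

/-- Standard tableaux of shape `μ` with `n` cells.  A cell `(i, j)` of `μ` lies in row `i`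
(counted from the bottom, French style) and column `j`; both are counted from `0`.
The number in the cell `c` is `entry c + 1`. -/
structure StdTableau (μ : YoungDiagram) (n : ℕ) where
  entry : {c // c ∈ μ.cells} ≃ Fin n
  row_lt : ∀ c d : {c // c ∈ μ.cells}, c.1.1 = d.1.1 → c.1.2 < d.1.2 → entry c < entry d
  col_lt : ∀ c d : {c // c ∈ μ.cells}, c.1.2 = d.1.2 → c.1.1 < d.1.1 → entry c < entry d

namespace StdTableau

variable {μ : YoungDiagram} {n : ℕ}

/-- The row, counted from the bottom, of the number `i + 1`. -/
def row (T : StdTableau μ n) (i : Fin n) : ℕ := (T.entry.symm i).1.1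

/-- The column of the number `i + 1`. -/
def col (T : StdTableau μ n) (i : Fin n) : ℕ := (T.entry.symm i).1.2

/-- The cocharge map `π`, at the number `i + 1`: it starts with `0`, keeps its value where the
next number is weakly southeast of the previous one, and grows by `1` otherwise (in a standard
tableau the next number is then weakly northwest of the previous one). -/
def cocharge (T : StdTableau μ n) : (i : ℕ) → i < n → ℕ
  | 0, _ => 0
  | i + 1, h =>
    if T.row ⟨i + 1, h⟩ ≤ T.row ⟨i, by omega⟩ ∧ T.col ⟨i, by omega⟩ ≤ T.col ⟨i + 1, h⟩ then
      cocharge T i (by omega)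
    else
      cocharge T i (by omega) + 1

/-- The row group `R(T)`: the permutations that map each row of `T` to itself. -/
def rowGroup (T : StdTableau μ n) : Finset (Equiv.Perm (Fin n)) :=
  Finset.univ.filter fun σ => ∀ i, T.row (σ i) = T.row i

/-- The bipermanent `[T, U]_per = ∑_{σ ∈ R(T)} ∏ᵢ z_{σ(i)}^{uᵢ}`, where `uᵢ` is the letter of `U`
in the cell that holds `i` in `T`, and `z_j^{(a, b)} = x_j^a y_j^b`. -/
noncomputable def bipermanent (T : StdTableau μ n) (U : {c // c ∈ μ.cells} → Alphabet) :
    PolyXY n :=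
  ∑ σ ∈ T.rowGroup, ∏ i : Fin n,
    (X (Sum.inl (σ i)) ^ (U (T.entry.symm i)).1.1 * X (Sum.inr (σ i)) ^ (U (T.entry.symm i)).1.2)

end StdTableau

/-- The cocharge diagram of a standard tableau `T`: the filling `h_γ ∘ π ∘ T`, where `h_γ` sends
the cocharge of the number `m₂ + p₂ + 1` to `(0, 0)`. -/
def cochargeDiagram (γ : HollowParam) {μ : YoungDiagram} (T : StdTableau μ γ.n) :
    {c // c ∈ μ.cells} → Alphabet := fun c =>
  shiftMap (T.cocharge (γ.m₂ + γ.p₂) (by unfold HollowParam.n; omega))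
    (T.cocharge (T.entry c) (T.entry c).isLt)

/-- The set `ℬ_γ` of all bipermanents `[T, V]_per`, where `T` is a standard tableau with `n` cells
and `V` is the cocharge diagram of a standard tableau of the same shape. -/
def hollowB (γ : HollowParam) : Set (PolyXY γ.n) :=
  {b | ∃ (μ : YoungDiagram) (T : StdTableau μ γ.n), ∃ V ∈ Set.range (cochargeDiagram γ (μ := μ)),
    b = T.bipermanent V}

/-- `|X(b)|`, the degree of `b` in the variables `x`. -/
noncomputable def xDeg {n : ℕ} (b : PolyXY n) : ℕ :=
  b.weightedTotalDegree (Sum.elim (fun _ => 1) (fun _ => 0))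

/-- `|Y(b)|`, the degree of `b` in the variables `y`. -/
noncomputable def yDeg {n : ℕ} (b : PolyXY n) : ℕ :=
  b.weightedTotalDegree (Sum.elim (fun _ => 0) (fun _ => 1))

section Degree

variable {μ : YoungDiagram} {n : ℕ}

theorem StdTableau.weightedTotalDegree_bipermanent (T : StdTableau μ n)
    (U : {c // c ∈ μ.cells} → Alphabet) (a b : ℕ) :
    (T.bipermanent U).weightedTotalDegree (Sum.elim (fun _ => a) (fun _ => b)) =
      ∑ c, ((U c).1.1 * a + (U c).1.2 * b) := by
  classical
  set w : Fin n ⊕ Fin n → ℕ := Sum.elim (fun _ => a) (fun _ => b) with hw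
  have hhom : IsWeightedHomogeneous w (T.bipermanent U)
      (∑ c, ((U c).1.1 * a + (U c).1.2 * b)) := by
    rw [StdTableau.bipermanent]
    apply IsWeightedHomogeneous.sum
    intro σ _
    rw [← Equiv.sum_comp T.entry.symm]
    apply IsWeightedHomogeneous.prod
    intro i _
    have h1 := (isWeightedHomogeneous_X ℂ w (Sum.inl (σ i))).pow (U (T.entry.symm i)).1.1
    have h2 := (isWeightedHomogeneous_X ℂ w (Sum.inr (σ i))).pow (U (T.entry.symm i)).1.2
    simpa [hw] using h1.mul h2
  have hne : T.bipermanent U ≠ 0 := by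
    intro h0
    have h1 := congrArg (MvPolynomial.eval (fun _ => (1 : ℂ))) h0
    simp only [StdTableau.bipermanent, map_sum, map_prod, map_mul, map_pow, eval_X, one_pow,
      mul_one, Finset.prod_const_one, Finset.sum_const, map_zero, nsmul_eq_mul,
      Nat.cast_eq_zero, Finset.card_eq_zero] at h1
    have : (1 : Equiv.Perm (Fin n)) ∈ T.rowGroup := by simp [StdTableau.rowGroup]
    simp [h1] at this
  have := hhom.weighted_total_degree hne
  rw [weightedTotalDegree_coe w _ hne] at this
  exact_mod_cast this

/-- For a bipermanent `b = [T, V]_per`, `|X(b)|` is the sum of the first entries of `V`. -/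
theorem xDeg_bipermanent (T : StdTableau μ n) (U : {c // c ∈ μ.cells} → Alphabet) :
    xDeg (T.bipermanent U) = ∑ c, (U c).1.1 := by
  simpa [xDeg, yDeg] using T.weightedTotalDegree_bipermanent U 1 0

/-- For a bipermanent `b = [T, V]_per`, `|Y(b)|` is the sum of the second entries of `V`. -/
theorem yDeg_bipermanent (T : StdTableau μ n) (U : {c // c ∈ μ.cells} → Alphabet) :
    yDeg (T.bipermanent U) = ∑ c, (U c).1.2 := by
  simpa [xDeg, yDeg] using T.weightedTotalDegree_bipermanent U 0 1

end Degree

instance (μ : YoungDiagram) (n : ℕ) : Finite (StdTableau μ n) :=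
  Finite.of_injective (fun T : StdTableau μ n => T.entry) (by
    rintro ⟨e, _, _⟩ ⟨f, _, _⟩ h
    simpa using h)

theorem finite_shapes (n : ℕ) : {μ : YoungDiagram | Nonempty (StdTableau μ n)}.Finite := by
  classical
  refine Set.Finite.of_finite_image (f := YoungDiagram.cells)
    (Set.Finite.subset (Finset.finite_toSet (Finset.range n ×ˢ Finset.range n).powerset) ?_)
    (fun μ _ ν _ h => YoungDiagram.ext h)
  rintro _ ⟨μ, ⟨T⟩, rfl⟩
  have hcard : μ.cells.card = n := by
    simpa using Fintype.card_congr T.entry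
  simp only [Finset.coe_powerset, Set.mem_preimage, Set.mem_powerset_iff]
  rintro ⟨i, j⟩ hij
  have hij' : (i, j) ∈ μ := (YoungDiagram.mem_cells _).1 hij
  have h1 : ((Finset.range (i + 1)).image fun a => (a, 0)) ⊆ μ.cells := by
    intro c hc
    obtain ⟨a, ha, rfl⟩ := Finset.mem_image.1 hc
    exact (YoungDiagram.mem_cells _).2
      (μ.up_left_mem (by have := Finset.mem_range.1 ha; omega) (Nat.zero_le _) hij')
  have h2 : ((Finset.range (j + 1)).image fun a => (0, a)) ⊆ μ.cells := by
    intro c hc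
    obtain ⟨a, ha, rfl⟩ := Finset.mem_image.1 hc
    exact (YoungDiagram.mem_cells _).2
      (μ.up_left_mem (Nat.zero_le _) (by have := Finset.mem_range.1 ha; omega) hij')
  have h1' := Finset.card_le_card h1
  have h2' := Finset.card_le_card h2
  rw [Finset.card_image_of_injective _ (fun a b h => by simpa using h), Finset.card_range,
    hcard] at h1' h2'
  simp only [Finset.coe_product, Finset.coe_range, Set.mem_prod, Set.mem_Iio]
  omega

theorem hollowB_finite (γ : HollowParam) : (hollowB γ).Finite := by
  refine Set.Finite.subset ((finite_shapes γ.n).biUnion (t := fun μ =>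
    Set.range fun q : StdTableau μ γ.n × StdTableau μ γ.n =>
      q.1.bipermanent (cochargeDiagram γ q.2)) fun μ _ => Set.finite_range _) ?_
  rintro _ ⟨μ, T, _, ⟨U, rfl⟩, rfl⟩
  exact Set.mem_biUnion (x := μ) ⟨T⟩ ⟨(T, U), rfl⟩

/-- The monomial ideal `𝒢_γ`, generated by the `xᵢyᵢ`, by the products of `m₁ + p₁ + 1` distinct
variables `xᵢ`, and by the products of `m₂ + p₂ + 1` distinct variables `yᵢ`. -/
noncomputable def hollowG (γ : HollowParam) : Ideal (PolyXY γ.n) :=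
  Ideal.span
    (Set.range (fun i : Fin γ.n => (X (Sum.inl i) * X (Sum.inr i) : PolyXY γ.n)) ∪
      {f | ∃ D : Finset (Fin γ.n), D.card = γ.m₁ + γ.p₁ + 1 ∧ f = ∏ i ∈ D, X (Sum.inl i)} ∪
      {f | ∃ E : Finset (Fin γ.n), E.card = γ.m₂ + γ.p₂ + 1 ∧ f = ∏ i ∈ E, X (Sum.inr i)})

/-- The bihomogeneous polynomials of total degree `r` in the `x` and total degree `s` in the `y`. -/
noncomputable def bihomogeneous (n r s : ℕ) : Submodule ℂ (PolyXY n) :=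
  weightedHomogeneousSubmodule ℂ
    (Sum.elim (fun _ => ((1, 0) : ℕ × ℕ)) (fun _ => ((0, 1) : ℕ × ℕ))) (r, s)

/-- The component of bidegree `(r, s)` of `ℂ[Xₙ, Yₙ] / I`: the image of the bihomogeneous
polynomials of bidegree `(r, s)`. -/
noncomputable def quotientComponent {n : ℕ} (I : Ideal (PolyXY n)) (r s : ℕ) :
    Submodule ℂ (PolyXY n ⧸ I) :=
  (bihomogeneous n r s).map (Ideal.Quotient.mkₐ ℂ I).toLinearMap

/-- The bigraded Hilbert series of `ℂ[Xₙ, Yₙ] / I`, a formal power series in two variables `t`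
(of index `0`) and `q` (of index `1`): the coefficient of `t^r q^s` is the dimension of the
component of bidegree `(r, s)`. -/
noncomputable def hilbertSeries {n : ℕ} (I : Ideal (PolyXY n)) : MvPowerSeries (Fin 2) ℚ :=
  fun d => (Module.finrank ℂ (quotientComponent I (d 0) (d 1)) : ℚ)

/-- `(z)_j = (1 - z)(1 - z²) ⋯ (1 - z^j)`. -/
noncomputable def risingProd (z : MvPowerSeries (Fin 2) ℚ) (j : ℕ) : MvPowerSeries (Fin 2) ℚ :=
  ∏ i ∈ Finset.range j, (1 - z ^ (i + 1))

/-! Put N₁ = m₁ + p₁ and N₂ = m₂ + p₂, so n = N₁ + N₂ + 1. The ideal is monomial, so the Hilbert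
series counts the monomials outside it. Since no xᵢyᵢ divides such a monomial, it is a word u of n
integers (positive letters are powers of x, negative ones powers of y) with at most N₁ positive and
at most N₂ negative letters. This bound says exactly that the increasing rearrangement a of u
vanishes at its position N₂ + 1.

The words with rearrangement a are as many as the pairs (T, U) of standard tableaux of one shape
with a compatible with U, that is, weakly increasing, and strictly where the next number of U lies
in a higher row. RSK would give a bijection; here only the numbers are compared
(`card_arrangements_eq_pairCount`), by removing the block of k largest letters. For words this costs
a binomial coefficient. For tableaux, the k largest numbers of U form a horizontal strip, and the
number of T whose shape exceeds a given shape by a horizontal strip contains the same binomial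
coefficient (`sum_strip_eq`, a counting form of the Pieri rule). The latter follows from the
commutation of adding a cell with removing a strip (`card_add_cell_strip`) and Pascal's rule.

For fixed U, the compatible sequences vanishing at N₂ + 1 arise from the normalized cocharge
sequence of U by adding arbitrary natural numbers to its n - 1 differences. The bidegree is linear
in these, and a unit at each difference weighs t, …, t^N₁ or q, …, q^N₂. So U contributes its
cocharge monomial divided by (t)_{N₁} (q)_{N₂} (`ncard_isCompatFn`, `prod_stepWeight`).

The outcome is a sum over pairs (T, U), and `TableauPair.bipermanent_injective` turns it into a sum
over the set of bipermanents. -/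

/-! ### Lattice words and horizontal strips -/

section LatticeWords

/-- The multiset `s` is the list of row indices of the cells of a Ferrers diagram. -/
def IsPart (s : Multiset ℕ) : Prop := ∀ i, s.count (i + 1) ≤ s.count i

/-- `t` arises from `s` by adding a horizontal strip. -/
def IsStrip (s t : Multiset ℕ) : Prop := ∀ i, s.count i ≤ t.count i ∧ t.count (i + 1) ≤ s.count i

/-- Lattice words, written from right to left. -/
def IsLattice : List ℕ → Prop
  | [] => True
  | r :: l => IsLattice l ∧ IsPart (r :: l : List ℕ)

theorem IsLattice.isPart : ∀ {l : List ℕ}, IsLattice l → IsPart (l : Multiset ℕ)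
  | [], _ => fun i => by simp
  | _ :: _, h => h.2

theorem IsPart.mem_of_le {s : Multiset ℕ} (hs : IsPart s) {i j : ℕ} (hij : i ≤ j) (hj : j ∈ s) :
    i ∈ s := by
  induction j, hij using Nat.le_induction with
  | base => exact hj
  | succ k _ ih =>
    refine ih ?_
    have := hs k
    rw [← Multiset.count_pos] at hj ⊢
    omega

/-- All rows up to j are occupied. Hence the bound on the new letter in `latticeWords` excludes
nothing. -/
theorem IsPart.lt_card {s : Multiset ℕ} (hs : IsPart s) {j : ℕ} (hj : j ∈ s) :
    j < s.card := by
  have h : Finset.range (j + 1) ⊆ s.toFinset := fun i hi => by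
    rw [Multiset.mem_toFinset]
    exact hs.mem_of_le (by simpa [Nat.lt_succ_iff] using hi) hj
  have := (Finset.card_le_card h).trans (Multiset.toFinset_card_le s)
  simpa using this

theorem IsStrip.le {s t : Multiset ℕ} (h : IsStrip s t) : s ≤ t :=
  Multiset.le_iff_count.2 fun i => (h i).1

open Classical in
/-- The lattice words of length `n`. -/
noncomputable def latticeWords : ℕ → Finset (List ℕ)
  | 0 => {[]}
  | n + 1 => (latticeWords n).biUnion fun l =>
      ((Finset.range (n + 1)).filter fun r => IsPart (r :: l : List ℕ)).image fun r => r :: l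

theorem mem_latticeWords {n : ℕ} {l : List ℕ} :
    l ∈ latticeWords n ↔ l.length = n ∧ IsLattice l := by
  induction n generalizing l with
  | zero =>
    simp only [latticeWords, Finset.mem_singleton, List.length_eq_zero_iff]
    exact ⟨fun h => ⟨h, h ▸ trivial⟩, fun h => h.1⟩
  | succ n ih =>
    simp only [latticeWords, Finset.mem_biUnion, Finset.mem_image, Finset.mem_filter,
      Finset.mem_range, ih]
    constructor
    · rintro ⟨l, ⟨rfl, hl⟩, r, ⟨_, hr⟩, rfl⟩
      exact ⟨rfl, hl, hr⟩
    · rintro ⟨hn, hl⟩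
      cases l with
      | nil => simp at hn
      | cons r l =>
        refine ⟨l, ⟨by simpa using hn, hl.1⟩, r, ⟨?_, hl.2⟩, rfl⟩
        have := hl.2.lt_card (j := r) (by simp)
        simpa [hn] using this

open Classical in
theorem sum_latticeWords_succ (n : ℕ) (g : List ℕ → ℕ) :
    ∑ w ∈ latticeWords (n + 1), g w = ∑ w ∈ latticeWords n,
      ∑ r ∈ (Finset.range (n + 1)).filter (fun r => IsPart (r :: w : List ℕ)), g (r :: w) := by
  rw [latticeWords, Finset.sum_biUnion]
  · refine Finset.sum_congr rfl fun w _ => ?_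
    rw [Finset.sum_image fun a _ b _ h => (List.cons.inj h).1]
  · intro a _ b _ hab
    rw [Function.onFun, Finset.disjoint_left]
    intro x hx hx'
    simp only [Finset.mem_image, Finset.mem_filter] at hx hx'
    obtain ⟨r, _, rfl⟩ := hx
    obtain ⟨s, _, h⟩ := hx'
    exact hab (List.cons.inj h).2.symm

theorem count_cons_nat (i r : ℕ) (s : Multiset ℕ) :
    (r ::ₘ s).count i = s.count i + if i = r then 1 else 0 := Multiset.count_cons i r s

theorem count_erase_nat (i r : ℕ) (s : Multiset ℕ) :
    (s.erase r).count i = s.count i - if i = r then 1 else 0 := by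
  split_ifs with h
  · rw [h, Multiset.count_erase_self]
  · rw [Multiset.count_erase_of_ne h, Nat.sub_zero]

/-- A strip can always grow in row 0; row i + 1 can grow as long as it stays within row i of the
inner shape. The inequality is the one in `isPart_erase_of_isStrip` for removing a cell of row i,
which produces the shift by one row in `card_add_cell_strip`. -/
theorem isPart_cons_of_isStrip {s t : Multiset ℕ} (ht : IsPart t) (h : IsStrip s t) {r : ℕ} :
    (IsPart (r ::ₘ t) ∧ IsStrip s (r ::ₘ t)) ↔ r = 0 ∨ ∃ i, r = i + 1 ∧ t.count (i + 1) < s.count i := by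
  constructor
  · rintro ⟨_, h2⟩
    cases r with
    | zero => exact Or.inl rfl
    | succ i =>
      refine Or.inr ⟨i, rfl, ?_⟩
      have := (h2 i).2
      rw [count_cons_nat, if_pos rfl] at this
      omega
  · rintro (rfl | ⟨i, rfl, hi⟩)
    · refine ⟨fun j => ?_, fun j => ?_⟩ <;> have a := ht j <;> have b := h j <;>
        simp only [count_cons_nat] <;> split_ifs <;> first | omega | contradiction
    · have := (h i).1
      refine ⟨fun j => ?_, fun j => ?_⟩ <;> have := ht j <;> have := h j <;>
        simp only [count_cons_nat] <;> split_ifs <;>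
        first | omega | (obtain rfl : j = i := by omega) ; omega

theorem isPart_erase_of_isStrip {s t : Multiset ℕ} (hs : IsPart s) (h : IsStrip s t) {r : ℕ} :
    (r ∈ s ∧ IsPart (s.erase r) ∧ IsStrip (s.erase r) t) ↔ t.count (r + 1) < s.count r := by
  constructor
  · rintro ⟨h0, _, h2⟩
    have := (h2 r).2
    rw [← Multiset.count_pos] at h0
    rw [count_erase_nat, if_pos rfl] at this
    omega
  · intro hr
    refine ⟨Multiset.count_pos.1 (by omega), fun j => ?_, fun j => ?_⟩ <;>
      have := hs j <;> have := h j <;> have := h (j + 1) <;>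
        simp only [count_erase_nat] <;> split_ifs <;>
        first | omega | (obtain rfl : j = r := by omega) ; omega

/-- If one cell repairs a failure of the strip condition, the failure is that row r of the inner
shape is too long by exactly one. Lengthening that row outside and shortening it inside are then
equally good. -/
theorem isStrip_cons_iff_of_not {s t : Multiset ℕ} (hs : IsPart s) (ht : IsPart t)
    (h : ¬ IsStrip s t) {r : ℕ} :
    (IsPart (r ::ₘ t) ∧ IsStrip s (r ::ₘ t)) ↔
      (r ∈ s ∧ IsPart (s.erase r) ∧ IsStrip (s.erase r) t) := by
  constructor
  · rintro ⟨h1, h2⟩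
    have key : s.count r = t.count r + 1 := by
      by_contra hne
      apply h
      intro j
      have a := h2 j
      have b := h2 r
      simp only [count_cons_nat] at a b
      constructor
      · rcases eq_or_ne j r with rfl | hj
        · simp at b; omega
        · simp [hj] at a; omega
      · have := a.2; split_ifs at this <;> omega
    refine ⟨Multiset.count_pos.1 (by omega), fun j => ?_, fun j => ?_⟩ <;>
      have a := h1 j <;> have b := h2 j <;> have c := h2 (j + 1) <;> have := ht j <;> have := hs j <;>
      simp only [count_erase_nat, count_cons_nat] at * <;>
      by_cases e1 : j = r <;> by_cases e2 : j + 1 = r <;> simp_all <;> omega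
  · rintro ⟨h0, h1, h2⟩
    rw [← Multiset.count_pos] at h0
    have key : s.count r = t.count r + 1 := by
      by_contra hne
      apply h
      intro j
      have a := h2 j
      have b := h2 r
      simp only [count_erase_nat] at a b
      constructor
      · rcases eq_or_ne j r with rfl | hj
        · simp at b; omega
        · simp [hj] at a; omega
      · have := a.2; omega
    refine ⟨fun j => ?_, fun j => ?_⟩ <;>
      have a := h1 j <;> have b := h2 j <;> have c := h2 (j + 1) <;> have := ht j <;> have := hs j <;>
      simp only [count_erase_nat, count_cons_nat] at * <;>
      by_cases e1 : j = r <;> by_cases e2 : j + 1 = r <;> simp_all <;> omega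

open Classical in
/-- The commutation rule between adding a cell and removing a horizontal strip. -/
theorem card_add_cell_strip {s t : Multiset ℕ} (hs : IsPart s) (ht : IsPart t) {n : ℕ}
    (hn : t.card = n) :
    ((Finset.range (n + 1)).filter fun r => IsPart (r ::ₘ t) ∧ IsStrip s (r ::ₘ t)).card =
      (s.toFinset.filter fun r => IsPart (s.erase r) ∧ IsStrip (s.erase r) t).card +
        if IsStrip s t then 1 else 0 := by
  by_cases h : IsStrip s t
  · rw [if_pos h]
    -- Removing from row i corresponds to adding to row i + 1; adding to row 0 is the one surplus
    -- case.
    have e : ((Finset.range (n + 1)).filter fun r => IsPart (r ::ₘ t) ∧ IsStrip s (r ::ₘ t)) =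
        insert 0 ((s.toFinset.filter fun r =>
          IsPart (s.erase r) ∧ IsStrip (s.erase r) t).image (· + 1)) := by
      ext r
      simp only [Finset.mem_filter, Finset.mem_range, Finset.mem_insert, Finset.mem_image,
        Multiset.mem_toFinset, isPart_erase_of_isStrip hs h, isPart_cons_of_isStrip ht h]
      constructor
      · rintro ⟨_, rfl | ⟨i, rfl, hi⟩⟩
        · exact Or.inl rfl
        · exact Or.inr ⟨i, hi, rfl⟩
      · rintro (rfl | ⟨i, hi, rfl⟩)
        · exact ⟨by omega, Or.inl rfl⟩
        · refine ⟨?_, Or.inr ⟨i, rfl, hi⟩⟩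
          have : i < t.card := ht.lt_card (Multiset.count_pos.1 (by have := (h i).1; omega))
          omega
    rw [e, Finset.card_insert_of_notMem (by simp),
      Finset.card_image_of_injective _ (add_left_injective 1)]
  · rw [if_neg h, add_zero]
    congr 1
    ext r
    simp only [Finset.mem_filter, Finset.mem_range, Multiset.mem_toFinset,
      isStrip_cons_iff_of_not hs ht h]
    refine ⟨fun h => h.2, fun h' => ⟨?_, h'⟩⟩
    have := ((isStrip_cons_iff_of_not hs ht h).2 h').1.lt_card (j := r) (by simp)
    simpa [hn] using this

open Classical in
/-- The number of lattice words with given content. -/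
noncomputable def latticeCount (s : Multiset ℕ) : ℕ :=
  ∑ w ∈ latticeWords s.card, if (w : Multiset ℕ) = s then 1 else 0

-- Branching rule: the last letter of a lattice word names a removable corner.
open Classical in
theorem latticeCount_eq_sum {s : Multiset ℕ} (hs : IsPart s) (h0 : s ≠ 0) :
    latticeCount s =
      ∑ r ∈ s.toFinset.filter (fun r => IsPart (s.erase r)), latticeCount (s.erase r) := by
  obtain ⟨n, hn⟩ : ∃ n, s.card = n + 1 :=
    Nat.exists_eq_succ_of_ne_zero (by simpa using h0)
  have h1 : ∀ r ∈ s.toFinset.filter (fun r => IsPart (s.erase r)),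
      latticeCount (s.erase r) =
        ∑ w ∈ latticeWords n, if (w : Multiset ℕ) = s.erase r then 1 else 0 := by
    intro r hr
    have hr' : r ∈ s := by simpa using (Finset.mem_filter.1 hr).1
    rw [latticeCount, Multiset.card_erase_of_mem hr', hn, Nat.pred_succ]
  rw [Finset.sum_congr rfl h1, Finset.sum_comm, latticeCount, hn, sum_latticeWords_succ]
  refine Finset.sum_congr rfl fun w hw => ?_
  rw [← Finset.card_filter, ← Finset.card_filter]
  congr 1
  ext r
  have hw' := mem_latticeWords.1 hw
  simp only [Finset.mem_filter, Finset.mem_range, Multiset.mem_toFinset]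
  constructor
  · rintro ⟨⟨_, _⟩, rfl⟩
    simpa using hw'.2.isPart
  · rintro ⟨⟨h1, h2⟩, h3⟩
    have h4 : ((r :: w : List ℕ) : Multiset ℕ) = s := by
      rw [← Multiset.cons_coe, h3, Multiset.cons_erase h1]
    refine ⟨⟨?_, h4 ▸ hs⟩, h4⟩
    have := hs.lt_card h1
    omega

-- Counting form of the Pieri rule. In the induction on n, the commutation rule yields a sum over
-- the corners of s, which `latticeCount_eq_sum` collapses, and a term for s itself; Pascal's rule
-- adds the two.
open Classical in
theorem sum_strip_eq (n : ℕ) {s : Multiset ℕ} (hs : IsPart s) :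
    (∑ w ∈ latticeWords n, if IsStrip s w then 1 else 0) = n.choose s.card * latticeCount s := by
  induction n generalizing s with
  | zero =>
    have h0 : IsStrip s (([] : List ℕ) : Multiset ℕ) ↔ s = 0 := by
      constructor
      · intro h; simpa using h.le
      · rintro rfl; intro i; simp
    simp only [latticeWords, Finset.sum_singleton, h0]
    split_ifs with h
    · subst h; simp [latticeCount, latticeWords]
    · rw [Nat.choose_eq_zero_of_lt (Multiset.card_pos.2 h), zero_mul]
  | succ n ih =>
    have h1 : ∀ w ∈ latticeWords n,
        (∑ r ∈ (Finset.range (n + 1)).filter (fun r => IsPart (r :: w : List ℕ)),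
          if IsStrip s (r :: w : List ℕ) then 1 else 0) =
        (∑ r ∈ s.toFinset.filter (fun r => IsPart (s.erase r)),
          if IsStrip (s.erase r) w then 1 else 0) + if IsStrip s w then 1 else 0 := by
      intro w hw
      obtain ⟨hw1, hw2⟩ := mem_latticeWords.1 hw
      have := card_add_cell_strip hs hw2.isPart (by simpa using hw1)
      rw [← Finset.card_filter, ← Finset.card_filter, Finset.filter_filter, Finset.filter_filter]
      exact this
    rw [sum_latticeWords_succ, Finset.sum_congr rfl h1, Finset.sum_add_distrib, Finset.sum_comm,
      ih hs]
    rw [Finset.sum_congr rfl fun r hr => ih (Finset.mem_filter.1 hr).2]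
    by_cases h0 : s = 0
    · subst h0; simp
    · obtain ⟨k, hk⟩ : ∃ k, s.card = k + 1 :=
        Nat.exists_eq_succ_of_ne_zero (by simpa using h0)
      have h2 : ∀ r ∈ s.toFinset.filter (fun r => IsPart (s.erase r)),
          n.choose (s.erase r).card * latticeCount (s.erase r) =
            n.choose k * latticeCount (s.erase r) := by
        intro r hr
        have hr' : r ∈ s := by simpa using (Finset.mem_filter.1 hr).1
        rw [Multiset.card_erase_of_mem hr', hk, Nat.pred_succ]
      rw [Finset.sum_congr rfl h2, ← Finset.mul_sum, ← latticeCount_eq_sum hs h0, hk,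
        Nat.choose_succ_succ, add_mul]

end LatticeWords

/-! ### Counting rearrangements of a multiset -/

section Rearrangements

open Classical in
/-- The lists with a given multiset of entries. -/
noncomputable def arrangements (s : Multiset ℤ) : Finset (List ℤ) := s.lists.toFinset

theorem mem_arrangements {s : Multiset ℤ} {l : List ℤ} :
    l ∈ arrangements s ↔ (l : Multiset ℤ) = s := by
  rw [arrangements, Multiset.mem_toFinset, Multiset.mem_lists_iff, eq_comm]
  rfl

theorem card_arrangements_zero : (arrangements 0).card = 1 := by
  rw [Finset.card_eq_one]
  exact ⟨[], by ext l; simp [mem_arrangements]⟩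

theorem card_arrangements_eq_sum {s : Multiset ℤ} (h0 : s ≠ 0) :
    (arrangements s).card = ∑ x ∈ s.toFinset, (arrangements (s.erase x)).card := by
  have e : arrangements s =
      s.toFinset.biUnion fun x => (arrangements (s.erase x)).image (x :: ·) := by
    ext l
    simp only [mem_arrangements, Finset.mem_biUnion, Multiset.mem_toFinset, Finset.mem_image]
    constructor
    · rintro rfl
      cases l with
      | nil => simp at h0
      | cons x l => exact ⟨x, by simp, l, by simp, rfl⟩
    · rintro ⟨x, hx, l, hl, rfl⟩
      rw [← Multiset.cons_coe, hl, Multiset.cons_erase hx]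
  rw [e, Finset.card_biUnion]
  · exact Finset.sum_congr rfl fun x _ =>
      Finset.card_image_of_injective _ fun a b h => (List.cons.inj h).2
  · intro x _ y _ hxy
    rw [Function.onFun, Finset.disjoint_left]
    intro l hl hl'
    obtain ⟨a, _, rfl⟩ := Finset.mem_image.1 hl
    obtain ⟨b, _, h⟩ := Finset.mem_image.1 hl'
    exact hxy (List.cons.inj h).1.symm

/-- The binomial coefficient chooses the places of the letters other than z. The same recursion
holds for `pairCount`. -/
theorem card_arrangements_replicate_add (z : ℤ) (k : ℕ) (s : Multiset ℤ) (hz : z ∉ s) :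
    (arrangements (Multiset.replicate k z + s)).card =
      (k + s.card).choose s.card * (arrangements s).card := by
  obtain ⟨n, hn⟩ : ∃ n, n = k + s.card := ⟨_, rfl⟩
  induction n generalizing k s with
  | zero =>
    obtain rfl : k = 0 := by omega
    simp
  | succ n ih =>
    cases k with
    | zero => simp
    | succ k =>
      by_cases hs : s = 0
      · subst hs
        have := ih k 0 (by simp) (by simp at hn ⊢; omega)
        rw [card_arrangements_eq_sum (by simp [Multiset.replicate_succ])]
        rw [add_zero] at this ⊢
        rw [Multiset.toFinset_replicate, if_neg (by omega), Finset.sum_singleton,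
          Multiset.replicate_succ, Multiset.erase_cons_head, this]
        simp
      · obtain ⟨m, hm⟩ : ∃ m, s.card = m + 1 :=
          Nat.exists_eq_succ_of_ne_zero (by simpa using hs)
        have htf : (Multiset.replicate (k + 1) z + s).toFinset = insert z s.toFinset := by
          rw [Multiset.toFinset_add, Multiset.toFinset_replicate, if_neg (by omega),
            Finset.insert_eq]
        have h1 : ∀ x ∈ s.toFinset,
            (arrangements ((Multiset.replicate (k + 1) z + s).erase x)).card =
              (k + 1 + m).choose m * (arrangements (s.erase x)).card := by
          intro x hx
          rw [Multiset.mem_toFinset] at hx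
          have hc : (s.erase x).card = m := by
            rw [Multiset.card_erase_of_mem hx, hm, Nat.pred_succ]
          rw [Multiset.erase_add_right_pos _ hx,
            ih (k + 1) (s.erase x) (fun h => hz (Multiset.mem_of_mem_erase h)) (by omega), hc]
        rw [card_arrangements_eq_sum (by simp), htf,
          Finset.sum_insert (by simpa using hz), Finset.sum_congr rfl h1, ← Finset.mul_sum,
          ← card_arrangements_eq_sum hs, Multiset.replicate_succ, Multiset.cons_add,
          Multiset.erase_cons_head, ih k s hz (by omega), hm, ← add_mul]
        congr 1
        have e : k + 1 + (m + 1) = (k + m + 1) + 1 := by ring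
        rw [e, Nat.choose_succ_succ, add_comm]
        congr 2; ring

end Rearrangements

/-! ### Words versus pairs of lattice words: an enumerative RSK -/

section Compatible

/-- The order on biletters for which compatible pairs of words are sorted. -/
def BiletterRel (p q : ℤ × ℕ) : Prop := q.1 < p.1 ∨ q.1 = p.1 ∧ p.2 ≤ q.2

/-- The integers `a` decrease weakly, and strictly where the word `w` has a descent
(both are written from right to left). -/
def IsCompat (w : List ℕ) (a : List ℤ) : Prop := (a.zip w).Pairwise BiletterRel

theorem zip_replicate_left (z : ℤ) : ∀ v : List ℕ,
    (List.replicate v.length z).zip v = v.map (Prod.mk z)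
  | [] => rfl
  | r :: v => by simp [List.replicate_succ, zip_replicate_left z v]

theorem isCompat_append {v w : List ℕ} {z : ℤ} {a : List ℤ} (ha : ∀ y ∈ a, y < z) :
    IsCompat (v ++ w) (List.replicate v.length z ++ a) ↔ v.Pairwise (· ≤ ·) ∧ IsCompat w a := by
  rw [IsCompat, List.zip_append (by simp), List.pairwise_append, zip_replicate_left,
    List.pairwise_map]
  simp only [BiletterRel, lt_irrefl, false_or, true_and]
  refine and_congr_right fun _ => and_iff_left ?_
  intro p hp q hq
  obtain ⟨r, _, rfl⟩ := List.mem_map.1 hp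
  exact Or.inl (ha _ (List.of_mem_zip hq).1)

/-- The head of a list is its last letter, so a sorted v fills the higher rows first. When row i + 1
grows, row i still has its length from w, and the lattice condition becomes the horizontal strip
condition. -/
theorem isLattice_append {v w : List ℕ} (hv : v.Pairwise (· ≤ ·)) :
    IsLattice (v ++ w) ↔
      IsLattice w ∧ ∀ i, (v ++ w).count (i + 1) ≤ w.count i := by
  induction v with
  | nil =>
    rw [List.nil_append]
    exact ⟨fun h => ⟨h, fun i => by simpa using h.isPart i⟩, fun h => h.1⟩
  | cons r v ih =>
    rw [List.pairwise_cons] at hv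
    rw [List.cons_append, IsLattice, ih hv.2, and_assoc]
    refine and_congr_right fun hw => ?_
    have hnot : ∀ i, i < r → v.count i = 0 := fun i hi =>
      List.count_eq_zero.2 fun h => by have := hv.1 i h; omega
    have hp : ∀ i, w.count (i + 1) ≤ w.count i := fun i => by simpa using hw.isPart i
    constructor
    · rintro ⟨h1, h2⟩ i
      have a := h1 i
      have b := h2 i
      simp only [Multiset.coe_count, List.count_cons, List.count_append, beq_iff_eq] at a b ⊢
      by_cases h : r = i + 1
      · subst h
        have := hnot i (by omega)
        simp at b ⊢
        omega
      · simp [h]; omega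
    · intro h
      refine ⟨fun i => ?_, fun i => ?_⟩ <;> have a := h i <;>
        simp only [Multiset.coe_count, List.count_cons, List.count_append, beq_iff_eq] at a ⊢ <;>
        split_ifs at * <;> omega

theorem isStrip_of_isLattice_append {v w : List ℕ} (hv : v.Pairwise (· ≤ ·))
    (h : IsLattice (v ++ w)) : IsStrip w (v ++ w : List ℕ) := fun i =>
  ⟨by simp [List.count_append], by simpa using ((isLattice_append hv).1 h).2 i⟩

open Classical in
/-- The number of pairs of lattice words with the same content, the second of which is compatible
with `a`. -/
noncomputable def pairCount (a : List ℤ) : ℕ :=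
  ∑ w ∈ (latticeWords a.length).filter (fun w => IsCompat w a), latticeCount w

theorem pairCount_nil : pairCount [] = 1 := by
  simp [pairCount, latticeWords, IsCompat, latticeCount, Finset.filter_singleton]

-- In a compatible word the block over the letters z is sorted, so the shapes before and after the
-- block determine it. What remains is a word compatible with `a` and a second lattice word whose
-- content exceeds that of the first by a horizontal strip; `sum_strip_eq` counts the choices of the
-- latter.
open Classical in
theorem pairCount_replicate_append {k : ℕ} {z : ℤ} {a : List ℤ} (ha : ∀ y ∈ a, y < z) :
    pairCount (List.replicate k z ++ a) = (k + a.length).choose a.length * pairCount a := by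
  set n := k + a.length with hn
  have hlen : (List.replicate k z ++ a).length = n := by simp [hn]
  have e1 : pairCount (List.replicate k z ++ a) =
      ((latticeWords n ×ˢ latticeWords n).filter fun p =>
        IsCompat p.1 (List.replicate k z ++ a) ∧ (p.2 : Multiset ℕ) = p.1).card := by
    rw [pairCount, hlen, Finset.card_filter, Finset.sum_product, Finset.sum_filter]
    refine Finset.sum_congr rfl fun w hw => ?_
    split_ifs with h
    · simp [h, latticeCount, (mem_latticeWords.1 hw).1]
    · simp [h]
  have e2 : (n.choose a.length) * pairCount a =
      ((latticeWords a.length ×ˢ latticeWords n).filter fun p =>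
        IsCompat p.1 a ∧ IsStrip p.1 p.2).card := by
    rw [pairCount, Finset.card_filter, Finset.sum_product, Finset.sum_filter, Finset.mul_sum]
    refine Finset.sum_congr rfl fun w hw => ?_
    obtain ⟨h1, h2⟩ := mem_latticeWords.1 hw
    have := sum_strip_eq n h2.isPart
    rw [Multiset.coe_card, h1] at this
    split_ifs with h
    · simp only [h, true_and, this]
    · simp [h]
  rw [e1, e2]
  -- One map forgets the block, the other restores it as the sorted difference of the two contents.
  refine Finset.card_nbij' (fun p => (p.1.drop k, p.2))
    (fun p => (((p.2 : Multiset ℕ) - (p.1 : Multiset ℕ)).sort (· ≤ ·) ++ p.1, p.2)) ?_ ?_ ?_ ?_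
  · rintro ⟨w', w⟩ h
    simp only [Finset.coe_filter, Finset.mem_product, mem_latticeWords, Set.mem_ofPred_eq] at h ⊢
    obtain ⟨⟨⟨h1, h2⟩, h3, h4⟩, h5, h6⟩ := h
    obtain ⟨v, u, rfl, rfl⟩ : ∃ v u, w' = v ++ u ∧ k = v.length :=
      ⟨w'.take k, w'.drop k, by simp, by simp; omega⟩
    rw [isCompat_append ha] at h5
    have := isStrip_of_isLattice_append h5.1 h2
    rw [List.drop_left]
    rw [isLattice_append h5.1] at h2
    refine ⟨⟨⟨by simp at h1; omega, h2.1⟩, h3, h4⟩, h5.2, ?_⟩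
    rw [h6]; exact this
  · rintro ⟨u, w⟩ h
    simp only [Finset.coe_filter, Finset.mem_product, mem_latticeWords, Set.mem_ofPred_eq] at h ⊢
    obtain ⟨⟨⟨h1, h2⟩, h3, h4⟩, h5, h6⟩ := h
    set v := ((w : Multiset ℕ) - (u : Multiset ℕ)).sort (· ≤ ·) with hv
    have hv1 : v.Pairwise (· ≤ ·) := Multiset.pairwise_sort _ _
    have hv2 : ((v ++ u : List ℕ) : Multiset ℕ) = w := by
      rw [← Multiset.coe_add, hv, Multiset.sort_eq, tsub_add_cancel_of_le h6.le]
    have hlen : (v ++ u).length = n := by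
      rw [← Multiset.coe_card, hv2, Multiset.coe_card, h3]
    have hk : k = v.length := by simp at hlen; omega
    refine ⟨⟨⟨hlen, ?_⟩, h3, h4⟩, ?_, hv2.symm⟩
    · rw [isLattice_append hv1]
      refine ⟨h2, fun i => ?_⟩
      have := (h6 i).2
      rwa [← hv2, Multiset.coe_count, Multiset.coe_count] at this
    · rw [hk, isCompat_append ha]
      exact ⟨hv1, h5⟩
  · rintro ⟨w', w⟩ h
    simp only [Finset.coe_filter, Finset.mem_product, mem_latticeWords, Set.mem_ofPred_eq] at h ⊢
    obtain ⟨⟨⟨h1, h2⟩, h3, h4⟩, h5, h6⟩ := h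
    obtain ⟨v, u, rfl, rfl⟩ : ∃ v u, w' = v ++ u ∧ k = v.length :=
      ⟨w'.take k, w'.drop k, by simp, by simp; omega⟩
    rw [isCompat_append ha] at h5
    rw [List.drop_left, Prod.mk.injEq]
    refine ⟨?_, rfl⟩
    congr 1
    refine List.Perm.eq_of_pairwise (le := (· ≤ ·)) (fun _ _ _ _ => le_antisymm)
      (Multiset.pairwise_sort _ _) h5.1 ?_
    rw [← Multiset.coe_eq_coe, Multiset.sort_eq, h6, ← Multiset.coe_add, add_tsub_cancel_right]
  · rintro ⟨u, w⟩ h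
    simp only [Finset.coe_filter, Finset.mem_product, mem_latticeWords, Set.mem_ofPred_eq] at h ⊢
    obtain ⟨⟨⟨h1, h2⟩, h3, h4⟩, h5, h6⟩ := h
    rw [Prod.mk.injEq]
    refine ⟨?_, rfl⟩
    have : k = (((w : Multiset ℕ) - (u : Multiset ℕ)).sort (· ≤ ·)).length := by
      rw [Multiset.length_sort, Multiset.card_sub h6.le]
      simp; omega
    rw [this, List.drop_left]

theorem exists_replicate_append : ∀ (z : ℤ) (a : List ℤ), (z :: a).Pairwise (· ≥ ·) →
    ∃ (k : ℕ) (b : List ℤ), z :: a = List.replicate (k + 1) z ++ b ∧ ∀ y ∈ b, y < z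
  | z, [], _ => ⟨0, [], rfl, by simp⟩
  | z, y :: a, h => by
    rw [List.pairwise_cons] at h
    rcases (h.1 y (by simp)).eq_or_lt with rfl | hlt
    · obtain ⟨k, b, hk, hb⟩ := exists_replicate_append y a h.2
      exact ⟨k + 1, b, by rw [hk]; rfl, hb⟩
    · refine ⟨0, y :: a, rfl, fun x hx => ?_⟩
      rcases List.mem_cons.1 hx with rfl | hx
      · exact hlt
      · exact ((List.pairwise_cons.1 h.2).1 x hx).trans_lt hlt

/-- The number of rearrangements of a sorted list is the number of pairs of lattice words with the
same content, the second of which is compatible with the list. -/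
theorem card_arrangements_eq_pairCount (a : List ℤ) (ha : a.Pairwise (· ≥ ·)) :
    (arrangements a).card = pairCount a := by
  -- The induction runs over a bound for the length, since a whole block of equal letters is removed
  -- at once.
  obtain ⟨n, hn⟩ : ∃ n, a.length ≤ n := ⟨_, le_rfl⟩
  induction n generalizing a with
  | zero =>
    obtain rfl : a = [] := List.length_eq_zero_iff.1 (by omega)
    rw [pairCount_nil]; exact card_arrangements_zero
  | succ n ih =>
    cases a with
    | nil => rw [pairCount_nil]; exact card_arrangements_zero
    | cons z a =>
      obtain ⟨k, b, hk, hb⟩ := exists_replicate_append z a ha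
      rw [hk] at ha hn ⊢
      rw [pairCount_replicate_append hb, ← Multiset.coe_add, Multiset.coe_replicate,
        card_arrangements_replicate_add _ _ _ fun h => lt_irrefl z (hb z h),
        ih b (List.pairwise_append.1 ha).2.1 (by simp at hn; omega), Multiset.coe_card]

end Compatible

/-! ### Prefix counts of a word of rows -/

section RowWords

/-- The number of positions before `k` where `r` takes the value `i`. -/
def prefixCount {n : ℕ} (r : Fin n → ℕ) (k i : ℕ) : ℕ :=
  (Finset.univ.filter fun j : Fin n => j.val < k ∧ r j = i).card

theorem prefixCount_mono {n : ℕ} (r : Fin n → ℕ) {k l : ℕ} (h : k ≤ l) (i : ℕ) :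
    prefixCount r k i ≤ prefixCount r l i :=
  Finset.card_le_card fun j hj => by
    simp only [Finset.mem_filter, Finset.mem_univ, true_and] at hj ⊢
    exact ⟨by omega, hj.2⟩

theorem prefixCount_succ {n : ℕ} (r : Fin n → ℕ) (j : Fin n) :
    prefixCount r (j + 1) (r j) = prefixCount r j (r j) + 1 := by
  have : (Finset.univ.filter fun x : Fin n => x.val < j + 1 ∧ r x = r j) =
      insert j (Finset.univ.filter fun x : Fin n => x.val < j ∧ r x = r j) := by
    ext x
    simp only [Finset.mem_filter, Finset.mem_univ, true_and, Finset.mem_insert]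
    constructor
    · rintro ⟨h1, h2⟩
      rcases (Nat.lt_succ_iff.1 h1).eq_or_lt with h | h
      · exact Or.inl (Fin.ext h)
      · exact Or.inr ⟨h, h2⟩
    · rintro (rfl | ⟨h1, h2⟩)
      · simp
      · exact ⟨by omega, h2⟩
  rw [prefixCount, this, Finset.card_insert_of_notMem (by simp), prefixCount]

theorem prefixCount_lt {n : ℕ} (r : Fin n → ℕ) {j : Fin n} {k : ℕ} (h : j.val < k) :
    prefixCount r j (r j) < prefixCount r k (r j) := by
  have := prefixCount_mono r (show j.val + 1 ≤ k from h) (r j)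
  rw [prefixCount_succ] at this
  omega

theorem prefixCount_castSucc {n : ℕ} (r : Fin (n + 1) → ℕ) {k : ℕ} (hk : k ≤ n) (i : ℕ) :
    prefixCount (fun j : Fin n => r j.castSucc) k i = prefixCount r k i := by
  rw [prefixCount, ← Finset.card_map Fin.castSuccEmb, prefixCount]
  congr 1
  ext j
  simp only [Finset.mem_map, Finset.mem_filter, Finset.mem_univ, true_and, Fin.castSuccEmb_apply]
  constructor
  · rintro ⟨x, hx, rfl⟩; exact hx
  · intro h
    exact ⟨j.castLT (by omega), h, rfl⟩

theorem reverse_ofFn_succ {α : Type*} {n : ℕ} (r : Fin (n + 1) → α) :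
    (List.ofFn r).reverse = r (Fin.last n) :: (List.ofFn fun j : Fin n => r j.castSucc).reverse := by
  rw [List.ofFn_succ', List.concat_eq_append, List.reverse_append]
  rfl

theorem count_reverse_ofFn {n : ℕ} (r : Fin n → ℕ) (i : ℕ) :
    (List.ofFn r).reverse.count i = prefixCount r n i := by
  induction n with
  | zero => simp [prefixCount]
  | succ n ih =>
    rw [reverse_ofFn_succ, List.count_cons, ih, prefixCount_castSucc r le_rfl]
    have h := prefixCount_succ r (Fin.last n)
    rw [Fin.val_last] at h
    by_cases hi : r (Fin.last n) = i
    · subst hi; simp [h]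
    · simp only [beq_iff_eq, hi, if_false, add_zero, prefixCount]
      congr 1
      ext j
      simp only [Finset.mem_filter, Finset.mem_univ, true_and]
      refine ⟨fun h => ⟨by omega, h.2⟩, fun h => ⟨?_, h.2⟩⟩
      have : j ≠ Fin.last n := fun e => hi (e ▸ h.2)
      have := Fin.val_lt_last this
      simpa using this

theorem isLattice_reverse_ofFn {n : ℕ} (r : Fin n → ℕ) :
    IsLattice (List.ofFn r).reverse ↔
      ∀ k ≤ n, ∀ i, prefixCount r k (i + 1) ≤ prefixCount r k i := by
  induction n with
  | zero => simp [IsLattice, prefixCount]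
  | succ n ih =>
    have e := reverse_ofFn_succ r
    rw [e, IsLattice, ih, ← e, IsPart]
    simp only [Multiset.coe_count, count_reverse_ofFn]
    constructor
    · rintro ⟨h1, h2⟩ k hk i
      rcases hk.eq_or_lt with rfl | hlt
      · exact h2 i
      · have := h1 k (by omega) i
        rwa [prefixCount_castSucc r (by omega), prefixCount_castSucc r (by omega)] at this
    · intro h
      refine ⟨fun k hk i => ?_, h _ le_rfl⟩
      rw [prefixCount_castSucc r hk, prefixCount_castSucc r hk]
      exact h k (by omega) i

end RowWords

/-! ### Standard tableaux as lattice words -/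

namespace StdTableau

variable {μ : YoungDiagram} {n : ℕ}

theorem mem_row_col (T : StdTableau μ n) (i : Fin n) : (T.row i, T.col i) ∈ μ :=
  (YoungDiagram.mem_cells _).1 (T.entry.symm i).2

theorem col_lt_rowLen (T : StdTableau μ n) (i : Fin n) : T.col i < μ.rowLen (T.row i) :=
  YoungDiagram.mem_iff_lt_rowLen.1 (T.mem_row_col i)

theorem exists_cell (T : StdTableau μ n) {a b : ℕ} (h : (a, b) ∈ μ) :
    ∃ i, T.row i = a ∧ T.col i = b :=
  ⟨T.entry ⟨(a, b), (YoungDiagram.mem_cells _).2 h⟩, by simp [row], by simp [col]⟩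

theorem eq_of_row_col (T : StdTableau μ n) {i j : Fin n} (h1 : T.row i = T.row j)
    (h2 : T.col i = T.col j) : i = j :=
  T.entry.symm.injective (Subtype.ext (Prod.ext h1 h2))

theorem lt_of_col_lt (T : StdTableau μ n) {i j : Fin n} (h1 : T.row i = T.row j)
    (h2 : T.col i < T.col j) : i < j := by
  simpa using T.row_lt (T.entry.symm i) (T.entry.symm j) h1 h2

theorem lt_of_row_lt (T : StdTableau μ n) {i j : Fin n} (h1 : T.col i = T.col j)
    (h2 : T.row i < T.row j) : i < j := by
  simpa using T.col_lt (T.entry.symm i) (T.entry.symm j) h1 h2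

theorem le_of_row_le_col_le (T : StdTableau μ n) {i j : Fin n} (h1 : T.row i ≤ T.row j)
    (h2 : T.col i ≤ T.col j) : i ≤ j := by
  -- The comparison goes through the number k in the row of i and the column of j.
  obtain ⟨k, hk1, hk2⟩ := T.exists_cell (μ.up_left_mem h1 le_rfl (T.mem_row_col j))
  have a : i ≤ k := by
    rcases h2.eq_or_lt with h | h
    · exact (T.eq_of_row_col hk1.symm (h.trans hk2.symm)).le
    · exact (T.lt_of_col_lt hk1.symm (by omega)).le
  have b : k ≤ j := by
    rcases h1.eq_or_lt with h | h
    · exact (T.eq_of_row_col (hk1.trans h) hk2).le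
    · exact (T.lt_of_row_lt hk2 (by omega)).le
  exact a.trans b

theorem col_lt_iff (T : StdTableau μ n) {i j : Fin n} (h : T.row i = T.row j) :
    T.col i < T.col j ↔ i < j :=
  ⟨T.lt_of_col_lt h, fun hij => by
    by_contra hc
    exact absurd (T.le_of_row_le_col_le h.symm.le (not_lt.1 hc)) (not_le.2 hij)⟩

/-- The smaller numbers in the row of j are those to its left. Hence rows alone determine a tableau
(`ext_row`). -/
theorem prefixCount_row (T : StdTableau μ n) (j : Fin n) :
    prefixCount T.row j (T.row j) = T.col j := by
  rw [prefixCount, ← Finset.card_range (T.col j)]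
  refine Finset.card_bij (fun x _ => T.col x) ?_ ?_ ?_
  · intro x hx
    simp only [Finset.mem_filter, Finset.mem_univ, true_and, Finset.mem_range] at hx ⊢
    exact (T.col_lt_iff hx.2).2 hx.1
  · intro x hx y hy h
    simp only [Finset.mem_filter, Finset.mem_univ, true_and] at hx hy
    exact T.eq_of_row_col (hx.2.trans hy.2.symm) h
  · intro c hc
    rw [Finset.mem_range] at hc
    obtain ⟨x, hx1, hx2⟩ := T.exists_cell (μ.up_left_mem le_rfl hc.le (T.mem_row_col j))
    refine ⟨x, ?_, hx2⟩
    simp only [Finset.mem_filter, Finset.mem_univ, true_and]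
    exact ⟨T.lt_of_col_lt hx1 (by omega), hx1⟩

theorem prefixCount_row_last (T : StdTableau μ n) (i : ℕ) :
    prefixCount T.row n i = μ.rowLen i := by
  rw [prefixCount, ← Finset.card_range (μ.rowLen i)]
  refine Finset.card_bij (fun x _ => T.col x) ?_ ?_ ?_
  · intro x hx
    simp only [Finset.mem_filter, Finset.mem_univ, true_and, Finset.mem_range] at hx ⊢
    rw [← hx.2]
    exact T.col_lt_rowLen x
  · intro x hx y hy h
    simp only [Finset.mem_filter, Finset.mem_univ, true_and] at hx hy
    exact T.eq_of_row_col (hx.2.trans hy.2.symm) h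
  · intro c hc
    rw [Finset.mem_range, ← YoungDiagram.mem_iff_lt_rowLen] at hc
    obtain ⟨x, hx1, hx2⟩ := T.exists_cell hc
    exact ⟨x, by simp [hx1], hx2⟩

/-- Each number of row i + 1 is sent to the smaller number directly below it. -/
theorem prefixCount_row_succ_le (T : StdTableau μ n) (k i : ℕ) :
    prefixCount T.row k (i + 1) ≤ prefixCount T.row k i := by
  have h : ∀ x : Fin n, T.row x = i + 1 → ∃ y, T.row y = i ∧ T.col y = T.col x := fun x hx =>
    T.exists_cell (μ.up_left_mem (by omega) le_rfl (T.mem_row_col x))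
  choose! g hg1 hg2 using h
  refine Finset.card_le_card_of_injOn g ?_ ?_
  · intro x hx
    simp only [Finset.coe_filter, Finset.mem_univ, true_and, Set.mem_ofPred_eq] at hx ⊢
    have := T.lt_of_row_lt (hg2 x hx.2) (by rw [hg1 x hx.2, hx.2]; omega)
    exact ⟨by omega, hg1 x hx.2⟩
  · intro x hx y hy h
    simp only [Finset.coe_filter, Finset.mem_univ, true_and, Set.mem_ofPred_eq] at hx hy
    exact T.eq_of_row_col (hx.2.trans hy.2.symm) (by rw [← hg2 x hx.2, h, hg2 y hy.2])

/-- The word of the rows of `n, …, 2, 1`. -/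
def rowWord (T : StdTableau μ n) : List ℕ := (List.ofFn T.row).reverse

theorem rowWord_mem (T : StdTableau μ n) : T.rowWord ∈ latticeWords n :=
  mem_latticeWords.2 ⟨by simp [rowWord],
    (isLattice_reverse_ofFn _).2 fun k _ i => T.prefixCount_row_succ_le k i⟩

theorem count_rowWord (T : StdTableau μ n) (i : ℕ) : T.rowWord.count i = μ.rowLen i := by
  rw [rowWord, count_reverse_ofFn, prefixCount_row_last]

theorem ext_row {T U : StdTableau μ n} (h : T.row = U.row) : T = U := by
  have hcol : T.col = U.col := by
    funext j
    rw [← T.prefixCount_row, ← U.prefixCount_row, h]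
  have : T.entry = U.entry := by
    rw [← T.entry.symm_symm, ← U.entry.symm_symm]
    congr 1
    ext i
    · exact congrFun h i
    · exact congrFun hcol i
  cases T; cases U; simpa using this

theorem rowWord_injective : Function.Injective (rowWord : StdTableau μ n → List ℕ) :=
  fun _ _ h => ext_row (List.ofFn_injective (List.reverse_injective h))

/-- The number j goes into row `r j`, in the column given by how often that row has occurred before.
-/
theorem exists_rowWord {w : List ℕ} (hw : w ∈ latticeWords n) (hμ : ∀ i, w.count i = μ.rowLen i) :
    ∃ T : StdTableau μ n, T.rowWord = w := by
  obtain ⟨hlen, hlat⟩ := mem_latticeWords.1 hw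
  obtain ⟨r, rfl⟩ : ∃ r : Fin n → ℕ, w = (List.ofFn r).reverse := by
    subst hlen
    refine ⟨fun i => w.reverse[i.val]'(by simp), ?_⟩
    rw [← List.reverse_reverse w]
    congr 1
    apply List.ext_getElem <;> simp
  rw [isLattice_reverse_ofFn] at hlat
  simp only [count_reverse_ofFn] at hμ
  have hanti : ∀ k ≤ n, ∀ i j, i ≤ j → prefixCount r k j ≤ prefixCount r k i := fun k hk i j hij =>
    antitone_nat_of_succ_le (f := prefixCount r k) (hlat k hk) hij
  have hlt : ∀ i j : Fin n, r i = r j → i < j →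
      prefixCount r i (r i) < prefixCount r j (r j) := fun i j h hij => by
    rw [← h]; exact prefixCount_lt r hij
  have hinj : ∀ i j : Fin n, r i = r j → prefixCount r i (r i) = prefixCount r j (r j) → i = j := by
    intro i j h h'
    rcases lt_trichotomy i j with hij | hij | hij
    · have := hlt i j h hij; omega
    · exact hij
    · have := hlt j i h.symm hij; omega
  have hmem : ∀ j : Fin n, (r j, prefixCount r j (r j)) ∈ μ.cells := fun j => by
    rw [YoungDiagram.mem_cells, YoungDiagram.mem_iff_lt_rowLen, ← hμ]
    exact prefixCount_lt r j.2
  have hbij : Function.Bijective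
      (fun j : Fin n => (⟨(r j, prefixCount r j (r j)), hmem j⟩ : {c // c ∈ μ.cells})) := by
    constructor
    · intro i j h
      simp only [Subtype.mk.injEq, Prod.mk.injEq] at h
      exact hinj i j h.1 h.2
    · rintro ⟨⟨a, b⟩, hab⟩
      have himg : (Finset.univ.filter fun j : Fin n => j.val < n ∧ r j = a).image
          (fun j : Fin n => prefixCount r j (r j)) = Finset.range (μ.rowLen a) := by
        apply Finset.eq_of_subset_of_card_le
        · intro x hx
          obtain ⟨j, hj, rfl⟩ := Finset.mem_image.1 hx
          simp only [Finset.mem_filter, Finset.mem_univ, true_and] at hj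
          rw [Finset.mem_range, ← hμ, ← hj.2]
          exact prefixCount_lt r j.2
        · rw [Finset.card_image_of_injOn, Finset.card_range, ← hμ, prefixCount]
          intro i hi j hj h
          simp only [Finset.coe_filter, Finset.mem_univ, true_and, Set.mem_ofPred_eq] at hi hj
          exact hinj i j (hi.2.trans hj.2.symm) h
      have hb : b ∈ Finset.range (μ.rowLen a) := by
        rw [Finset.mem_range, ← YoungDiagram.mem_iff_lt_rowLen]
        exact (YoungDiagram.mem_cells _).1 hab
      rw [← himg] at hb
      obtain ⟨j, hj, rfl⟩ := Finset.mem_image.1 hb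
      simp only [Finset.mem_filter, Finset.mem_univ, true_and] at hj
      exact ⟨j, by simp [hj.2]⟩
  let e := Equiv.ofBijective _ hbij
  have he : ∀ c, (r (e.symm c), prefixCount r (e.symm c) (r (e.symm c))) = c.1 := fun c =>
    congrArg Subtype.val (e.apply_symm_apply c)
  refine ⟨⟨e.symm, ?_, ?_⟩, ?_⟩
  · intro c d h1 h2
    rw [← he c, ← he d] at h1 h2
    simp only at h1 h2
    rcases lt_trichotomy (e.symm c) (e.symm d) with hij | hij | hij
    · exact hij
    · rw [hij] at h2; omega
    · have := hlt _ _ h1.symm hij; omega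
  · intro c d h1 h2
    rw [← he c, ← he d] at h1 h2
    simp only at h1 h2
    rcases lt_trichotomy (e.symm c) (e.symm d) with hij | hij | hij
    · exact hij
    · rw [hij] at h2; omega
    -- If the upper cell were filled first, the lattice condition at that moment would force the
    -- lower row already to extend beyond this column.
    · have a := prefixCount_succ r (e.symm d)
      have b := hanti (e.symm d + 1) (by omega) _ _ h2.le
      have c' := prefixCount_mono r (show (e.symm d).val + 1 ≤ e.symm c from hij) (r (e.symm c))
      omega
  · rfl

end StdTableau

/-! ### Shapes, and pairs of tableaux of the same shape -/

theorem YoungDiagram.ext_rowLen {μ ν : YoungDiagram} (h : ∀ i, μ.rowLen i = ν.rowLen i) :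
    μ = ν := by
  apply YoungDiagram.ext
  ext ⟨i, j⟩
  rw [YoungDiagram.mem_cells, YoungDiagram.mem_cells, YoungDiagram.mem_iff_lt_rowLen,
    YoungDiagram.mem_iff_lt_rowLen, h]

theorem IsPart.exists_youngDiagram {s : Multiset ℕ} (hs : IsPart s) :
    ∃ μ : YoungDiagram, ∀ i, s.count i = μ.rowLen i := by
  have hanti : ∀ i j, i ≤ j → s.count j ≤ s.count i := fun i j hij =>
    antitone_nat_of_succ_le (f := fun i => s.count i) hs hij
  have hmem : ∀ c : ℕ × ℕ, c ∈ (Finset.range s.card ×ˢ Finset.range s.card).filter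
      (fun c : ℕ × ℕ => c.2 < s.count c.1) ↔ c.2 < s.count c.1 := fun c => by
    simp only [Finset.mem_filter, Finset.mem_product, Finset.mem_range, and_iff_right_iff_imp]
    intro h
    exact ⟨hs.lt_card (Multiset.count_pos.1 (by omega)), h.trans_le (Multiset.count_le_card _ _)⟩
  refine ⟨⟨(Finset.range s.card ×ˢ Finset.range s.card).filter
    (fun c : ℕ × ℕ => c.2 < s.count c.1), fun c d hdc hc => ?_⟩, fun i => ?_⟩
  · have hc' := (hmem c).1 hc
    exact (hmem d).2 (lt_of_le_of_lt hdc.2 (hc'.trans_le (hanti _ _ hdc.1)))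
  · refine eq_of_forall_lt_iff fun j => ?_
    rw [← YoungDiagram.mem_iff_lt_rowLen]
    exact (hmem (i, j)).symm

/-- Pairs of standard tableaux of the same shape with `n` cells. -/
abbrev TableauPair (n : ℕ) : Type := Σ μ : YoungDiagram, StdTableau μ n × StdTableau μ n

/-- The row words of a pair of tableaux. -/
def TableauPair.words {n : ℕ} (P : TableauPair n) : List ℕ × List ℕ :=
  (P.2.2.rowWord, P.2.1.rowWord)

theorem TableauPair.words_injective (n : ℕ) : Function.Injective (@TableauPair.words n) := by
  rintro ⟨μ, T, U⟩ ⟨ν, T', U'⟩ h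
  simp only [TableauPair.words, Prod.mk.injEq] at h
  obtain rfl : μ = ν := YoungDiagram.ext_rowLen fun i => by
    rw [← T.count_rowWord, h.2, T'.count_rowWord]
  rw [StdTableau.rowWord_injective h.1, StdTableau.rowWord_injective h.2]

theorem TableauPair.mem_range_words {n : ℕ} {p : List ℕ × List ℕ} :
    p ∈ Set.range (@TableauPair.words n) ↔
      p.1 ∈ latticeWords n ∧ p.2 ∈ latticeWords n ∧ (p.2 : Multiset ℕ) = p.1 := by
  constructor
  · rintro ⟨⟨μ, T, U⟩, rfl⟩
    refine ⟨U.rowWord_mem, T.rowWord_mem, Multiset.ext.2 fun i => ?_⟩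
    simp only [TableauPair.words, Multiset.coe_count, T.count_rowWord, U.count_rowWord]
  · rcases p with ⟨w, w'⟩
    rintro ⟨h1, h2, h3⟩
    obtain ⟨μ, hμ⟩ := (mem_latticeWords.1 h1).2.isPart.exists_youngDiagram
    obtain ⟨U, rfl⟩ := StdTableau.exists_rowWord h1 (μ := μ) (by simpa using hμ)
    obtain ⟨T, rfl⟩ := StdTableau.exists_rowWord h2 (μ := μ) (by
      intro i
      rw [← hμ, ← h3, Multiset.coe_count])
    exact ⟨⟨μ, T, U⟩, rfl⟩

instance (n : ℕ) : Finite (TableauPair n) :=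
  Finite.of_injective (fun P => (⟨P.words, by
      have := (TableauPair.mem_range_words (p := P.words)).1 ⟨P, rfl⟩
      exact Finset.mem_product.2 ⟨this.1, this.2.1⟩⟩ :
    {p // p ∈ latticeWords n ×ˢ latticeWords n}))
    fun _ _ h => TableauPair.words_injective n (congrArg Subtype.val h)

noncomputable instance (n : ℕ) : Fintype (TableauPair n) := Fintype.ofFinite _

/-- The word w encodes the second tableau U, and `latticeCount w` counts the partners T of the same
shape. -/
theorem sum_latticeWords_eq_sum_tableauPair (n : ℕ) (g : List ℕ → ℕ) :
    ∑ w ∈ latticeWords n, latticeCount w * g w = ∑ P : TableauPair n, g P.2.2.rowWord := by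
  classical
  have e : (latticeWords n ×ˢ latticeWords n).filter
      (fun p => (p.2 : Multiset ℕ) = p.1) = Finset.univ.image (@TableauPair.words n) := by
    ext p
    have := TableauPair.mem_range_words (n := n) (p := p)
    simp only [Finset.mem_filter, Finset.mem_product, Finset.mem_image, Finset.mem_univ, true_and,
      and_assoc]
    exact this.symm
  have h := Finset.sum_image (s := Finset.univ) (f := fun p : List ℕ × List ℕ => g p.1)
    ((TableauPair.words_injective n).injOn (s := _))
  rw [← e, Finset.sum_filter, Finset.sum_product] at h
  refine Eq.trans (Finset.sum_congr rfl fun w hw => ?_) h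
  simp only [latticeCount, Multiset.coe_card, (mem_latticeWords.1 hw).1, Finset.sum_mul, ite_mul,
    one_mul, zero_mul]

/-! ### Balanced words of signed letters and their sorting -/

section SignedWords

/-- The bidegree of a word of signed letters. -/
noncomputable def signedWeight {ι : Type*} [Fintype ι] (u : ι → ℤ) : Fin 2 →₀ ℕ :=
  Finsupp.single 0 (∑ i, (u i).toNat) + Finsupp.single 1 (∑ i, (-u i).toNat)

theorem signedWeight_zero {ι : Type*} [Fintype ι] (u : ι → ℤ) :
    signedWeight u 0 = ∑ i, (u i).toNat := by simp [signedWeight]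

theorem signedWeight_one {ι : Type*} [Fintype ι] (u : ι → ℤ) :
    signedWeight u 1 = ∑ i, (-u i).toNat := by simp [signedWeight]

theorem signedWeight_comp {ι : Type*} [Fintype ι] (u : ι → ℤ) (σ : Equiv.Perm ι) :
    signedWeight (u ∘ σ) = signedWeight u := by
  simp only [signedWeight, Function.comp_apply]
  rw [Equiv.sum_comp σ fun i => (u i).toNat, Equiv.sum_comp σ fun i => (-u i).toNat]

theorem finite_signedWeight {ι : Type*} [Fintype ι] (d : Fin 2 →₀ ℕ) :
    {u : ι → ℤ | signedWeight u = d}.Finite := by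
  refine Set.Finite.subset (Set.Finite.pi' (t := fun _ : ι => Set.Icc (-(d 1 : ℤ)) (d 0))
    fun _ => Set.finite_Icc _ _) ?_
  rintro u rfl i
  rw [signedWeight_zero, signedWeight_one]
  have h1 := Finset.single_le_sum (f := fun i => (u i).toNat) (fun _ _ => Nat.zero_le _)
    (Finset.mem_univ i)
  have h2 := Finset.single_le_sum (f := fun i => (-u i).toNat) (fun _ _ => Nat.zero_le _)
    (Finset.mem_univ i)
  rw [Set.mem_Icc]
  omega

/-- At most `N₁` letters are positive and at most `N₂` are negative. -/
def IsBalanced {ι : Type*} [Fintype ι] (N₁ N₂ : ℕ) (u : ι → ℤ) : Prop :=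
  (Finset.univ.filter fun i => 0 < u i).card ≤ N₁ ∧ (Finset.univ.filter fun i => u i < 0).card ≤ N₂

theorem isBalanced_comp {ι : Type*} [Fintype ι] {N₁ N₂ : ℕ} (u : ι → ℤ) (σ : Equiv.Perm ι) :
    IsBalanced N₁ N₂ (u ∘ σ) ↔ IsBalanced N₁ N₂ u := by
  have h : ∀ (p : ℤ → Prop) [DecidablePred p],
      (Finset.univ.filter fun i => p ((u ∘ σ) i)).card = (Finset.univ.filter fun i => p (u i)).card :=
    fun p _ => Finset.card_equiv σ (by simp)
  rw [IsBalanced, IsBalanced, h fun z => 0 < z, h fun z => z < 0]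

/-- At most N₂ negative letters means that the entry with index N₂ is not negative; at most N₁
positive ones among N₁ + N₂ + 1 means that it is not positive. This is why cocharge is normalized at
m₂ + p₂ + 1. -/
theorem isBalanced_iff_of_monotone {N₁ N₂ : ℕ} {a : Fin (N₁ + N₂ + 1) → ℤ} (ha : Monotone a) :
    IsBalanced N₁ N₂ a ↔ a ⟨N₂, by omega⟩ = 0 := by
  have h1 := Tuple.lt_card_lt_iff_apply_lt_of_monotone (j := ⟨N₂, by omega⟩) (a := 0) ha
  have h2 := Tuple.lt_card_le_iff_apply_le_of_monotone (j := ⟨N₂, by omega⟩) (a := 0) ha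
  have h3 := Finset.card_filter_add_card_filter_not (s := Finset.univ) (fun i => a i ≤ 0)
  simp only [not_le, Finset.card_univ, Fintype.card_fin] at h1 h2 h3
  rw [IsBalanced]
  constructor
  · rintro ⟨h4, h5⟩
    have := h2.1 (by omega)
    have := mt h1.2 (by omega)
    omega
  · intro h
    have := h2.2 h.le
    have := mt h1.1 (by omega)
    omega

/-- The integers `a` increase weakly, and strictly over the descents of `r`. -/
def IsCompatFn {n : ℕ} (r : Fin n → ℕ) (a : Fin n → ℤ) : Prop :=
  ∀ ⦃i j⦄, i < j → a i < a j ∨ a i = a j ∧ r j ≤ r i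

theorem IsCompatFn.monotone {n : ℕ} {r : Fin n → ℕ} {a : Fin n → ℤ} (h : IsCompatFn r a) :
    Monotone a := fun i j hij => by
  rcases hij.eq_or_lt with rfl | hlt
  · exact le_rfl
  · rcases h hlt with h | h
    · exact h.le
    · exact h.1.le

theorem zip_reverse_ofFn {α β : Type*} {n : ℕ} (a : Fin n → α) (b : Fin n → β) :
    (List.ofFn a).reverse.zip (List.ofFn b).reverse = (List.ofFn fun i => (a i, b i)).reverse := by
  induction n with
  | zero => simp
  | succ n ih => rw [reverse_ofFn_succ, reverse_ofFn_succ, reverse_ofFn_succ, List.zip_cons_cons, ih]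

theorem isCompat_reverse_ofFn {n : ℕ} (r : Fin n → ℕ) (a : Fin n → ℤ) :
    IsCompat (List.ofFn r).reverse (List.ofFn a).reverse ↔ IsCompatFn r a := by
  rw [IsCompat, zip_reverse_ofFn, List.pairwise_reverse, List.pairwise_ofFn]
  rfl

theorem comp_sort_eq_iff {n : ℕ} {a u : Fin n → ℤ} (ha : Monotone a) :
    u ∘ Tuple.sort u = a ↔ (List.ofFn u).Perm (List.ofFn a) := by
  constructor
  · rintro rfl
    exact ((Tuple.sort u).ofFn_comp_perm u).symm
  · intro h
    exact List.ofFn_injective ((((Tuple.sort u).ofFn_comp_perm u).trans h).eq_of_pairwise'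
      (Tuple.monotone_sort u).sortedLE_ofFn.pairwise ha.sortedLE_ofFn.pairwise)

theorem exists_ofFn_eq {α : Type*} {n : ℕ} {l : List α} (h : l.length = n) :
    ∃ f : Fin n → α, List.ofFn f = l := by
  subst h
  exact ⟨l.get, List.ofFn_get l⟩

open Classical in
theorem card_comp_sort_eq {n : ℕ} {a : Fin n → ℤ} (ha : Monotone a) {S : Finset (Fin n → ℤ)}
    (hS : ∀ u : Fin n → ℤ, u ∘ Tuple.sort u = a → u ∈ S) :
    (S.filter fun u => u ∘ Tuple.sort u = a).card = pairCount (List.ofFn a).reverse := by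
  rw [← card_arrangements_eq_pairCount]
  · refine Finset.card_bij (fun u _ => List.ofFn u) ?_ ?_ ?_
    · intro u hu
      rw [mem_arrangements, Multiset.coe_reverse, Multiset.coe_eq_coe, ← comp_sort_eq_iff ha]
      exact (Finset.mem_filter.1 hu).2
    · intro u _ v _ h
      exact List.ofFn_injective h
    · intro l hl
      rw [mem_arrangements, Multiset.coe_reverse, Multiset.coe_eq_coe] at hl
      obtain ⟨u, rfl⟩ := exists_ofFn_eq (n := n) (l := l) (by simpa using hl.length_eq)
      have := (comp_sort_eq_iff ha).2 hl
      exact ⟨u, Finset.mem_filter.2 ⟨hS u this, this⟩, rfl⟩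
  · rw [List.pairwise_reverse, List.pairwise_ofFn]
    intro i j hij
    exact ha hij.le

/-- Balanced words of signed letters correspond to pairs of standard tableaux, together with
a compatible increasing sequence. -/
theorem ncard_isBalanced (N₁ N₂ : ℕ) (d : Fin 2 →₀ ℕ) :
    {u : Fin (N₁ + N₂ + 1) → ℤ | signedWeight u = d ∧ IsBalanced N₁ N₂ u}.ncard =
      ∑ P : TableauPair (N₁ + N₂ + 1), {a : Fin (N₁ + N₂ + 1) → ℤ | signedWeight a = d ∧
        a ⟨N₂, by omega⟩ = 0 ∧ IsCompatFn P.2.2.row a}.ncard := by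
  classical
  set n := N₁ + N₂ + 1 with hn
  have hfin := finite_signedWeight (ι := Fin n) d
  set B := hfin.toFinset with hB
  have hBmem : ∀ u, u ∈ B ↔ signedWeight u = d := fun u => by simp [hB]
  set S := B.filter (IsBalanced N₁ N₂) with hS
  set A := B.filter (fun a : Fin n → ℤ => Monotone a ∧ a ⟨N₂, by omega⟩ = 0) with hA
  have hcard : ∀ p : (Fin n → ℤ) → Prop,
      {u : Fin n → ℤ | signedWeight u = d ∧ p u}.ncard = (B.filter p).card := fun p => by
    rw [← Set.ncard_coe_finset]
    congr 1
    ext u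
    simp [hBmem]
  have hmaps : Set.MapsTo (fun u : Fin n → ℤ => u ∘ Tuple.sort u) S A := by
    intro u hu
    simp only [hS, hA, Finset.coe_filter, Set.mem_ofPred_eq, hBmem] at hu ⊢
    refine ⟨(signedWeight_comp _ _).trans hu.1, Tuple.monotone_sort u, ?_⟩
    rw [← isBalanced_iff_of_monotone (Tuple.monotone_sort u), isBalanced_comp]
    exact hu.2
  have hfib : ∀ a ∈ A, (S.filter fun u => u ∘ Tuple.sort u = a).card =
      ∑ w ∈ latticeWords n, latticeCount w * if IsCompat w (List.ofFn a).reverse then 1 else 0 := by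
    intro a ha
    simp only [hA, Finset.mem_filter, hBmem] at ha
    rw [card_comp_sort_eq ha.2.1, pairCount, List.length_reverse, List.length_ofFn,
      Finset.sum_filter]
    · exact Finset.sum_congr rfl fun w _ => by split_ifs <;> simp
    · rintro u rfl
      rw [signedWeight_comp] at ha
      rw [hS, Finset.mem_filter, hBmem]
      refine ⟨ha.1, ?_⟩
      rw [← isBalanced_comp u (Tuple.sort u), isBalanced_iff_of_monotone ha.2.1]
      exact ha.2.2
  -- Words are grouped by their sorted form `a`; exchanging the sums then fixes the tableau and lets
  -- `a` vary. Monotonicity of `a` may be dropped at the end, as compatibility implies it.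
  rw [hcard, ← hS, Finset.card_eq_sum_card_fiberwise hmaps, Finset.sum_congr rfl hfib,
    Finset.sum_comm]
  simp only [← Finset.mul_sum]
  rw [sum_latticeWords_eq_sum_tableauPair n
    (fun w => ∑ a ∈ A, if IsCompat w (List.ofFn a).reverse then 1 else 0)]
  refine Finset.sum_congr rfl fun P _ => ?_
  rw [hcard, ← Finset.card_filter, hA, Finset.filter_filter]
  congr 1
  ext a
  simp only [Finset.mem_filter, StdTableau.rowWord, isCompat_reverse_ofFn]
  refine and_congr_right fun _ => ?_
  exact ⟨fun h => ⟨h.1.2, h.2⟩, fun h => ⟨⟨h.2.monotone, h.1⟩, h.2⟩⟩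

end SignedWords

/-! ### Generating functions of linear systems over the naturals -/

section LinearSystems

variable {τ : Type*}

theorem finite_sum_smul_eq {N : ℕ} {W : Fin N → τ →₀ ℕ} (hW : ∀ j, W j ≠ 0) (d : τ →₀ ℕ) :
    {c : Fin N → ℕ | ∑ j, c j • W j = d}.Finite := by
  refine Set.Finite.subset (Set.Finite.pi' (t := fun _ : Fin N => Set.Iic d.degree)
    fun _ => Set.finite_Iic _) ?_
  rintro c rfl j
  rw [Set.mem_Iic, map_sum]
  refine le_trans ?_ (Finset.single_le_sum (fun _ _ => Nat.zero_le _) (Finset.mem_univ j))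
  rw [map_nsmul, smul_eq_mul]
  exact Nat.le_mul_of_pos_right _ (Nat.pos_of_ne_zero (by simpa [Finsupp.degree_eq_zero_iff] using hW j))

/-- The generating function of the solutions of a linear system in natural numbers. -/
noncomputable def solutionSeries {N : ℕ} (W : Fin N → τ →₀ ℕ) : MvPowerSeries τ ℚ :=
  fun d => ({c : Fin N → ℕ | ∑ j, c j • W j = d}.ncard : ℚ)

theorem coeff_solutionSeries {N : ℕ} (W : Fin N → τ →₀ ℕ) (d : τ →₀ ℕ) :
    MvPowerSeries.coeff d (solutionSeries W) =
      ({c : Fin N → ℕ | ∑ j, c j • W j = d}.ncard : ℚ) := rfl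

theorem ncard_add_sum_smul_eq {N : ℕ} (W : Fin N → τ →₀ ℕ) (e : Fin N → ℕ) (d : τ →₀ ℕ) :
    ({c : Fin N → ℕ | ∑ j, (c j + e j) • W j = d}.ncard : ℚ) =
      MvPowerSeries.coeff d (MvPowerSeries.monomial (∑ j, e j • W j) 1 * solutionSeries W) := by
  rw [MvPowerSeries.coeff_monomial_mul]
  simp only [add_smul, Finset.sum_add_distrib]
  split_ifs with h
  · rw [one_mul, coeff_solutionSeries]
    congr 3
    ext c
    exact (eq_tsub_iff_add_eq_of_le h).symm
  · rw [Nat.cast_eq_zero, ← Set.ncard_empty (Fin N → ℕ)]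
    congr 1
    ext c
    simp only [Set.mem_ofPred_eq, Set.mem_empty_iff_false, iff_false]
    rintro rfl
    exact h le_add_self

/-- Solutions are split by whether the coordinate `c 0` vanishes; if not, it is lowered by one. In
`solutionSeries_mul_prod` this removes one geometric factor. -/
theorem ncard_solutions_succ {N : ℕ} {W : Fin (N + 1) → τ →₀ ℕ} (hW : ∀ j, W j ≠ 0)
    (d : τ →₀ ℕ) :
    {c : Fin (N + 1) → ℕ | ∑ j, c j • W j = d}.ncard =
      {c : Fin N → ℕ | ∑ j, c j • W j.succ = d}.ncard +
        {c : Fin (N + 1) → ℕ | ∑ j, (c j + (Pi.single 0 1 : Fin (N + 1) → ℕ) j) • W j = d}.ncard := by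
  have e1 : {c : Fin (N + 1) → ℕ | ∑ j, c j • W j = d} =
      (Fin.cons 0 '' {c : Fin N → ℕ | ∑ j, c j • W j.succ = d}) ∪
      ((fun c => c + Pi.single 0 1) '' {c : Fin (N + 1) → ℕ |
        ∑ j, (c j + (Pi.single 0 1 : Fin (N + 1) → ℕ) j) • W j = d}) := by
    ext c
    simp only [Set.mem_union, Set.mem_image, Set.mem_ofPred_eq]
    constructor
    · intro h
      rcases Nat.eq_zero_or_pos (c 0) with h0 | h0
      · refine Or.inl ⟨Fin.tail c, ?_, ?_⟩
        · rw [Fin.sum_univ_succ, h0, zero_smul, zero_add] at h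
          exact h
        · rw [← h0, Fin.cons_self_tail]
      · have hc : c - Pi.single 0 1 + Pi.single 0 1 = c := by
          ext j
          rcases eq_or_ne j 0 with rfl | hj
          · simp; omega
          · simp [hj]
        refine Or.inr ⟨c - Pi.single 0 1, ?_, hc⟩
        have : ∀ j, (c - Pi.single 0 1 : Fin (N + 1) → ℕ) j + (Pi.single 0 1 : Fin (N + 1) → ℕ) j = c j :=
          fun j => congrFun hc j
        rw [← h]
        exact Finset.sum_congr rfl fun j _ => by rw [this j]
    · rintro (⟨c, h, rfl⟩ | ⟨c, h, rfl⟩)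
      · rw [Fin.sum_univ_succ]
        simpa using h
      · exact h
  have hf := finite_sum_smul_eq hW d
  rw [e1] at hf ⊢
  rw [Set.ncard_union_eq ?_ (hf.subset Set.subset_union_left) (hf.subset Set.subset_union_right),
    Set.ncard_image_of_injective _ (Fin.cons_right_injective (α := fun _ => ℕ) 0),
    Set.ncard_image_of_injective _ (add_left_injective _)]
  rw [Set.disjoint_left]
  rintro _ ⟨c, _, rfl⟩ ⟨c', _, h⟩
  have := congrFun h 0
  simp at this

theorem solutionSeries_mul_prod {N : ℕ} {W : Fin N → τ →₀ ℕ} (hW : ∀ j, W j ≠ 0) :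
    solutionSeries W * ∏ j, (1 - MvPowerSeries.monomial (W j) 1) = 1 := by
  classical
  induction N with
  | zero =>
    rw [Finset.univ_eq_empty, Finset.prod_empty, mul_one]
    ext d
    rw [coeff_solutionSeries, MvPowerSeries.coeff_one]
    split_ifs with h
    · subst h; simp [Set.ncard_univ]
    · simp [Ne.symm h]
  | succ N ih =>
    rw [Fin.prod_univ_succ, ← mul_assoc]
    refine Eq.trans ?_ (ih (W := fun j => W j.succ) fun j => hW _)
    congr 1
    ext d
    have h := ncard_add_sum_smul_eq W (Pi.single 0 1) d
    have h0 : ∑ j, (Pi.single 0 1 : Fin (N + 1) → ℕ) j • W j = W 0 := by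
      rw [Finset.sum_eq_single 0] <;> simp +contextual
    rw [h0, mul_comm] at h
    rw [mul_sub, mul_one, map_sub, ← h, coeff_solutionSeries, coeff_solutionSeries,
      ncard_solutions_succ hW]
    push_cast
    ring

end LinearSystems

/-! ### Compatible sequences through their differences -/

section Differences

variable {N : ℕ}

/-- The sequence with differences `e` that vanishes at `m`. -/
def centeredSum (m : ℕ) (e : Fin N → ℕ) (i : Fin (N + 1)) : ℤ :=
  ((∑ j, e j * if m ≤ j.val ∧ j.val < i.val then 1 else 0 : ℕ) : ℤ) -
    (∑ j, e j * if i.val ≤ j.val ∧ j.val < m then 1 else 0 : ℕ)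

/-- On either side of m one of the two sums is empty, so positive and negative parts are linear in
`e`. -/
theorem toNat_centeredSum (m : ℕ) (e : Fin N → ℕ) (i : Fin (N + 1)) :
    (centeredSum m e i).toNat = ∑ j, e j * if m ≤ j.val ∧ j.val < i.val then 1 else 0 := by
  rcases le_total m i.val with h | h
  · have : ∑ j, (e j * if i.val ≤ j.val ∧ j.val < m then 1 else 0 : ℕ) = 0 :=
      Finset.sum_eq_zero fun j _ => by rw [if_neg (by omega), mul_zero]
    simp only [centeredSum, this]; omega
  · have : ∑ j, (e j * if m ≤ j.val ∧ j.val < i.val then 1 else 0 : ℕ) = 0 :=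
      Finset.sum_eq_zero fun j _ => by rw [if_neg (by omega), mul_zero]
    simp only [centeredSum, this]; omega

theorem toNat_neg_centeredSum (m : ℕ) (e : Fin N → ℕ) (i : Fin (N + 1)) :
    (-centeredSum m e i).toNat = ∑ j, e j * if i.val ≤ j.val ∧ j.val < m then 1 else 0 := by
  rcases le_total m i.val with h | h
  · have : ∑ j, (e j * if i.val ≤ j.val ∧ j.val < m then 1 else 0 : ℕ) = 0 :=
      Finset.sum_eq_zero fun j _ => by rw [if_neg (by omega), mul_zero]
    simp only [centeredSum, this]; omega
  · have : ∑ j, (e j * if m ≤ j.val ∧ j.val < i.val then 1 else 0 : ℕ) = 0 :=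
      Finset.sum_eq_zero fun j _ => by rw [if_neg (by omega), mul_zero]
    simp only [centeredSum, this]; omega

theorem centeredSum_self {m : ℕ} (hm : m < N + 1) (e : Fin N → ℕ) :
    centeredSum m e ⟨m, hm⟩ = 0 := by
  simp only [centeredSum]
  rw [Finset.sum_eq_zero fun j _ => by rw [if_neg (by omega), mul_zero], sub_self]

theorem centeredSum_succ (m : ℕ) (e : Fin N → ℕ) (j : Fin N) :
    centeredSum m e j.succ = centeredSum m e j.castSucc + e j := by
  have h : (e j : ℤ) = ∑ k, (e k : ℤ) * if k = j then 1 else 0 := by simp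
  rw [h]
  simp only [centeredSum, Nat.cast_sum, Nat.cast_mul, ← Finset.sum_sub_distrib,
    ← Finset.sum_add_distrib]
  refine Finset.sum_congr rfl fun k _ => ?_
  rw [← mul_sub, ← mul_sub, ← mul_add]
  congr 1
  simp only [Fin.val_succ, Fin.val_castSucc, Fin.ext_iff]
  push_cast
  split_ifs <;> omega

theorem eq_of_differences {a b : Fin (N + 1) → ℤ} {k : Fin (N + 1)} (hk : a k = b k)
    (h : ∀ j : Fin N, a j.succ - a j.castSucc = b j.succ - b j.castSucc) : a = b := by
  have key : ∀ i, a i - b i = a 0 - b 0 := fun i => by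
    induction i using Fin.induction with
    | zero => rfl
    | succ j ih => have := h j; omega
  funext i
  have h1 := key i
  have h2 := key k
  omega

/-- The bidegree contributed by the difference at `j`. -/
noncomputable def stepWeight (N₁ N₂ : ℕ) (j : Fin (N₁ + N₂)) : Fin 2 →₀ ℕ :=
  if N₂ ≤ j.val then Finsupp.single 0 (N₁ + N₂ - j.val) else Finsupp.single 1 (j.val + 1)

theorem stepWeight_ne_zero (N₁ N₂ : ℕ) (j : Fin (N₁ + N₂)) : stepWeight N₁ N₂ j ≠ 0 := by
  unfold stepWeight
  split_ifs
  · rw [Finsupp.single_ne_zero]; omega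
  · rw [Finsupp.single_ne_zero]; omega

/-- With the entry at N₂ fixed at 0, a unit at a difference j ≥ N₂ raises the N₁ + N₂ - j later
entries, and a unit at j < N₂ lowers the j + 1 entries up to j. -/
theorem signedWeight_centeredSum (N₁ N₂ : ℕ) (e : Fin (N₁ + N₂) → ℕ) :
    signedWeight (centeredSum N₂ e) = ∑ j, e j • stepWeight N₁ N₂ j := by
  ext x
  rw [Finsupp.finsetSum_apply]
  fin_cases x
  · change signedWeight (centeredSum N₂ e) 0 = ∑ j, (e j • stepWeight N₁ N₂ j) 0
    simp only [signedWeight_zero, toNat_centeredSum]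
    rw [Finset.sum_comm]
    refine Finset.sum_congr rfl fun j _ => ?_
    rw [← Finset.mul_sum, Finsupp.smul_apply, smul_eq_mul, ← Finset.card_filter, stepWeight]
    congr 1
    split_ifs with h
    · simp only [h, true_and, Finsupp.single_eq_same]
      have : (Finset.univ.filter fun i : Fin (N₁ + N₂ + 1) => j.val < i.val) =
          Finset.Ioi j.castSucc := by
        ext i; simp [Fin.lt_def]
      rw [this, Fin.card_Ioi, Fin.val_castSucc]; omega
    · simp [h]
  · change signedWeight (centeredSum N₂ e) 1 = ∑ j, (e j • stepWeight N₁ N₂ j) 1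
    simp only [signedWeight_one, toNat_neg_centeredSum]
    rw [Finset.sum_comm]
    refine Finset.sum_congr rfl fun j _ => ?_
    rw [← Finset.mul_sum, Finsupp.smul_apply, smul_eq_mul, ← Finset.card_filter, stepWeight]
    congr 1
    split_ifs with h
    · simp [not_lt.2 h]
    · simp only [not_le.1 h, and_true, Finsupp.single_eq_same]
      have : (Finset.univ.filter fun i : Fin (N₁ + N₂ + 1) => i.val ≤ j.val) =
          Finset.Iic j.castSucc := by
        ext i; simp [Fin.le_def]
      rw [this, Fin.card_Iic, Fin.val_castSucc]

/-- The indicator of the descents of a word. -/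
def descentStep (r : Fin (N + 1) → ℕ) (j : Fin N) : ℕ := if r j.succ ≤ r j.castSucc then 0 else 1

/-- The order on pairs is transitive, so compatibility need only be tested on neighbours. -/
theorem isCompatFn_iff (r : Fin (N + 1) → ℕ) (a : Fin (N + 1) → ℤ) :
    IsCompatFn r a ↔ ∀ j : Fin N, a j.castSucc + descentStep r j ≤ a j.succ := by
  let R : ℤ × ℕ → ℤ × ℕ → Prop := fun p q => p.1 < q.1 ∨ p.1 = q.1 ∧ q.2 ≤ p.2
  have : IsTrans (ℤ × ℕ) R := ⟨fun p q s h1 h2 => by simp only [R] at *; omega⟩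
  have h := Fin.liftFun_iff_succ R (f := fun i => (a i, r i))
  refine Iff.trans (Iff.trans ?_ h) (forall_congr' fun j => ?_)
  · exact Iff.rfl
  · simp only [R, descentStep]
    split_ifs <;> push_cast <;> omega

theorem isCompatFn_centeredSum (m : ℕ) (r : Fin (N + 1) → ℕ) (c : Fin N → ℕ) :
    IsCompatFn r (centeredSum m (c + descentStep r)) := by
  rw [isCompatFn_iff]
  intro j
  rw [centeredSum_succ, Pi.add_apply]
  push_cast
  omega

/-- A compatible sequence is given by the excess c of its differences over the forced ones, and c is
arbitrary. The forced part gives the monomial, the excess the series. -/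
theorem ncard_isCompatFn (N₁ N₂ : ℕ) (r : Fin (N₁ + N₂ + 1) → ℕ) (d : Fin 2 →₀ ℕ) :
    ({a : Fin (N₁ + N₂ + 1) → ℤ | signedWeight a = d ∧
        a ⟨N₂, by omega⟩ = 0 ∧ IsCompatFn r a}.ncard : ℚ) =
      MvPowerSeries.coeff d (MvPowerSeries.monomial
        (signedWeight (centeredSum N₂ (descentStep r))) 1 *
          solutionSeries (stepWeight N₁ N₂)) := by
  rw [signedWeight_centeredSum, ← ncard_add_sum_smul_eq, Nat.cast_inj]
  symm
  refine Set.ncard_congr (fun c _ => centeredSum N₂ (c + descentStep r)) ?_ ?_ ?_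
  · intro c hc
    exact ⟨(signedWeight_centeredSum _ _ _).trans hc, centeredSum_self _ _,
      isCompatFn_centeredSum _ _ _⟩
  · intro c c' _ _ h
    funext j
    have h1 := centeredSum_succ N₂ (c + descentStep r) j
    have h2 := centeredSum_succ N₂ (c' + descentStep r) j
    rw [h, h2, Pi.add_apply, Pi.add_apply] at h1
    push_cast at h1
    omega
  · rintro a ⟨h1, h2, h3⟩
    rw [isCompatFn_iff] at h3
    let c : Fin (N₁ + N₂) → ℕ := fun j =>
      (a j.succ - a j.castSucc - descentStep r j).toNat
    have hc : centeredSum N₂ (c + descentStep r) = a := by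
      refine eq_of_differences (k := ⟨N₂, by omega⟩) ?_ fun j => ?_
      · rw [centeredSum_self, h2]
      · rw [centeredSum_succ, Pi.add_apply]
        have := h3 j
        simp only [c]
        push_cast
        omega
    refine ⟨c, ?_, hc⟩
    rw [Set.mem_ofPred_eq, ← h1, ← hc, signedWeight_centeredSum]
    rfl

theorem prod_stepWeight (N₁ N₂ : ℕ) :
    ∏ j, (1 - MvPowerSeries.monomial (stepWeight N₁ N₂ j) (1 : ℚ)) =
      risingProd (MvPowerSeries.X 0) N₁ * risingProd (MvPowerSeries.X 1) N₂ := by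
  have h : ∀ j : Fin (N₁ + N₂), (1 - MvPowerSeries.monomial (stepWeight N₁ N₂ j) (1 : ℚ)) =
      (fun k : ℕ => 1 - if N₂ ≤ k then (MvPowerSeries.X 0 : MvPowerSeries (Fin 2) ℚ) ^ (N₁ + N₂ - k)
        else MvPowerSeries.X 1 ^ (k + 1)) j.val := fun j => by
    simp only [stepWeight, MvPowerSeries.X_pow_eq]
    split_ifs <;> rfl
  rw [Finset.prod_congr rfl fun j _ => h j, Fin.prod_univ_eq_prod_range (fun k : ℕ =>
    1 - if N₂ ≤ k then (MvPowerSeries.X 0 : MvPowerSeries (Fin 2) ℚ) ^ (N₁ + N₂ - k)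
      else MvPowerSeries.X 1 ^ (k + 1)), add_comm N₁ N₂,
    Finset.prod_range_add, mul_comm, risingProd, risingProd]
  congr 1
  -- The exponents of t run downwards from N₁ to 1.
  · rw [← Finset.prod_range_reflect]
    refine Finset.prod_congr rfl fun k hk => ?_
    have := Finset.mem_range.1 hk
    rw [if_pos (by omega)]
    congr 2
    omega
  · refine Finset.prod_congr rfl fun k hk => ?_
    have := Finset.mem_range.1 hk
    rw [if_neg (by omega)]

end Differences

/-! ### Standard monomials of the ideal -/

section MonomialIdeal

/-- A polynomial lies in a monomial ideal iff each of its monomials does, so the classes of the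
monomials outside the ideal form a basis. -/
theorem finrank_quotientComponent {n : ℕ} {I : Ideal (PolyXY n)} {S : Set (Fin n ⊕ Fin n →₀ ℕ)}
    (hI : I = Ideal.span ((fun s => monomial s (1 : ℂ)) '' S)) (r s : ℕ) :
    Module.finrank ℂ (quotientComponent I r s) =
      {e : Fin n ⊕ Fin n →₀ ℕ | Finsupp.weight
        (Sum.elim (fun _ => ((1, 0) : ℕ × ℕ)) (fun _ => ((0, 1) : ℕ × ℕ))) e = (r, s) ∧
          ∀ x ∈ S, ¬ x ≤ e}.ncard := by
  set w : Fin n ⊕ Fin n → ℕ × ℕ :=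
    Sum.elim (fun _ => ((1, 0) : ℕ × ℕ)) (fun _ => ((0, 1) : ℕ × ℕ)) with hw
  set E := {e : Fin n ⊕ Fin n →₀ ℕ | Finsupp.weight w e = (r, s) ∧ ∀ x ∈ S, ¬ x ≤ e} with hE
  have hmem : ∀ p : PolyXY n, p ∈ I ↔ ∀ e ∈ p.support, ∃ x ∈ S, x ≤ e := fun p => by
    rw [hI]; exact mem_ideal_span_monomial_image
  let v : E → PolyXY n ⧸ I := fun e => Ideal.Quotient.mkₐ ℂ I (monomial e.1 1)
  have hspan : quotientComponent I r s = Submodule.span ℂ (Set.range v) := by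
    apply le_antisymm
    · rintro _ ⟨p, hp, rfl⟩
      have hp' : IsWeightedHomogeneous w p (r, s) := hp
      change Ideal.Quotient.mkₐ ℂ I p ∈ _
      rw [p.as_sum, map_sum]
      refine Submodule.sum_mem _ fun e he => ?_
      have hcoeff : monomial e (coeff e p) = coeff e p • monomial e (1 : ℂ) := by
        rw [smul_monomial, smul_eq_mul, mul_one]
      rw [hcoeff, map_smul]
      refine Submodule.smul_mem _ _ ?_
      by_cases h : ∃ x ∈ S, x ≤ e
      · have : monomial e (1 : ℂ) ∈ I := by
          rw [hmem]
          intro e' he'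
          rw [support_monomial, if_neg one_ne_zero, Finset.mem_singleton] at he'
          rw [he']; exact h
        have h0 : Ideal.Quotient.mkₐ ℂ I (monomial e (1 : ℂ)) = 0 :=
          Ideal.Quotient.eq_zero_iff_mem.2 this
        rw [h0]
        exact Submodule.zero_mem _
      · push Not at h
        exact Submodule.subset_span ⟨⟨e, hp' (mem_support_iff.1 he), h⟩, rfl⟩
    · rw [Submodule.span_le]
      rintro _ ⟨e, rfl⟩
      exact ⟨monomial e.1 1, isWeightedHomogeneous_monomial w e.1 1 e.2.1, rfl⟩
  have hli : LinearIndependent ℂ v := by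
    rw [linearIndependent_iff']
    intro t g hg i hi
    by_contra hne
    have h1 : Ideal.Quotient.mkₐ ℂ I (∑ i ∈ t, monomial i.1 (g i)) = 0 := by
      rw [map_sum, ← hg]
      refine Finset.sum_congr rfl fun j _ => ?_
      rw [← map_smul, smul_monomial, smul_eq_mul, mul_one]
    have h2 := (hmem _).1 (Ideal.Quotient.eq_zero_iff_mem.1 h1) i.1 (by
      classical
      rw [mem_support_iff, coeff_sum, Finset.sum_eq_single i]
      · simpa using hne
      · intro j _ hj
        rw [coeff_monomial, if_neg fun h => hj (Subtype.ext h)]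
      · exact fun h => absurd hi h)
    obtain ⟨x, hx, hxi⟩ := h2
    exact i.2.2 x hx hxi
  rw [hspan, Module.finrank_eq_nat_card_basis (Module.Basis.span hli)]
  rfl

/-- The exponents of the generators of `hollowG`. -/
def hollowExponents (n N₁ N₂ : ℕ) : Set (Fin n ⊕ Fin n →₀ ℕ) :=
  Set.range (fun i : Fin n => Finsupp.single (Sum.inl i) 1 + Finsupp.single (Sum.inr i) 1) ∪
    {e | ∃ D : Finset (Fin n), D.card = N₁ + 1 ∧ e = ∑ i ∈ D, Finsupp.single (Sum.inl i) 1} ∪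
    {e | ∃ D : Finset (Fin n), D.card = N₂ + 1 ∧ e = ∑ i ∈ D, Finsupp.single (Sum.inr i) 1}

theorem monomial_sum_single {n : ℕ} (D : Finset (Fin n)) (f : Fin n → Fin n ⊕ Fin n) :
    monomial (∑ i ∈ D, Finsupp.single (f i) 1) (1 : ℂ) = ∏ i ∈ D, X (f i) := by
  rw [monomial_sum_one]
  rfl

theorem hollowG_eq_span (γ : HollowParam) : hollowG γ = Ideal.span
    ((fun s => monomial s (1 : ℂ)) '' hollowExponents γ.n (γ.m₁ + γ.p₁) (γ.m₂ + γ.p₂)) := by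
  rw [hollowG, hollowExponents, Set.image_union, Set.image_union, ← Set.range_comp]
  congr 1
  refine congrArg₂ _ (congrArg₂ _ ?_ ?_) ?_
  · congr 1
    funext i
    simp only [Function.comp_apply, X, monomial_mul, mul_one]
  · ext f
    constructor
    · rintro ⟨D, hD, rfl⟩
      exact ⟨_, ⟨D, hD, rfl⟩, monomial_sum_single D _⟩
    · rintro ⟨_, ⟨D, hD, rfl⟩, rfl⟩
      exact ⟨D, hD, monomial_sum_single D _⟩
  · ext f
    constructor
    · rintro ⟨D, hD, rfl⟩
      exact ⟨_, ⟨D, hD, rfl⟩, monomial_sum_single D _⟩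
    · rintro ⟨_, ⟨D, hD, rfl⟩, rfl⟩
      exact ⟨D, hD, monomial_sum_single D _⟩

theorem sum_single_le_iff {n : ℕ} (D : Finset (Fin n)) {f : Fin n → Fin n ⊕ Fin n}
    (hf : Function.Injective f) (e : Fin n ⊕ Fin n →₀ ℕ) :
    ∑ i ∈ D, Finsupp.single (f i) 1 ≤ e ↔ ∀ i ∈ D, 0 < e (f i) := by
  classical
  have h : ∀ x, (∑ i ∈ D, Finsupp.single (f i) 1) x = ∑ i ∈ D, if f i = x then 1 else 0 := fun x => by
    rw [Finsupp.finsetSum_apply]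
    exact Finset.sum_congr rfl fun i _ => Finsupp.single_apply
  constructor
  · intro hle i hi
    have := hle (f i)
    rw [h, Finset.sum_eq_single i (fun j _ hj => if_neg fun h => hj (hf h)) (fun h => absurd hi h),
      if_pos rfl] at this
    exact this
  · intro hpos x
    rw [h]
    by_cases hx : ∃ i ∈ D, f i = x
    · obtain ⟨i, hi, rfl⟩ := hx
      rw [Finset.sum_eq_single i (fun j _ hj => if_neg fun h => hj (hf h)) (fun h => absurd hi h),
        if_pos rfl]
      exact hpos i hi
    · push Not at hx
      rw [Finset.sum_eq_zero fun i hi => if_neg (hx i hi)]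
      exact Nat.zero_le _

theorem forall_not_sum_single_le {n N : ℕ} {f : Fin n → Fin n ⊕ Fin n}
    (hf : Function.Injective f) (e : Fin n ⊕ Fin n →₀ ℕ) :
    (∀ D : Finset (Fin n), D.card = N + 1 → ¬ ∑ i ∈ D, Finsupp.single (f i) 1 ≤ e) ↔
      (Finset.univ.filter fun i => 0 < e (f i)).card ≤ N := by
  simp only [sum_single_le_iff _ hf]
  constructor
  · intro h
    by_contra hc
    obtain ⟨D, hD, hcard⟩ := Finset.exists_subset_card_eq (Nat.succ_le_of_lt (not_le.1 hc))
    exact h D hcard fun i hi => (Finset.mem_filter.1 (hD hi)).2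
  · intro h D hD hall
    have : D ⊆ Finset.univ.filter fun i => 0 < e (f i) := fun i hi =>
      Finset.mem_filter.2 ⟨Finset.mem_univ _, hall i hi⟩
    have := Finset.card_le_card this
    omega

theorem not_hollowExponents_le_iff {n N₁ N₂ : ℕ} (e : Fin n ⊕ Fin n →₀ ℕ) :
    (∀ x ∈ hollowExponents n N₁ N₂, ¬ x ≤ e) ↔
      (∀ i, e (Sum.inl i) = 0 ∨ e (Sum.inr i) = 0) ∧
      (Finset.univ.filter fun i => 0 < e (Sum.inl i)).card ≤ N₁ ∧
      (Finset.univ.filter fun i => 0 < e (Sum.inr i)).card ≤ N₂ := by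
  rw [← forall_not_sum_single_le Sum.inl_injective, ← forall_not_sum_single_le Sum.inr_injective]
  have h1 : ∀ i : Fin n, (Finsupp.single (Sum.inl i) 1 + Finsupp.single (Sum.inr i) 1 ≤ e) ↔
      ¬ (e (Sum.inl i) = 0 ∨ e (Sum.inr i) = 0) := by
    intro i
    constructor
    · intro h
      have a := h (Sum.inl i)
      have b := h (Sum.inr i)
      simp at a b
      omega
    · intro h x
      simp only [Finsupp.add_apply, Finsupp.single_apply]
      rcases x with k | k
      · by_cases hk : i = k
        · subst hk; simp; omega
        · simp [hk]
      · by_cases hk : i = k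
        · subst hk; simp; omega
        · simp [hk]
  constructor
  · intro h
    refine ⟨fun i => ?_, fun D hD => h _ (Or.inl (Or.inr ⟨D, hD, rfl⟩)),
      fun D hD => h _ (Or.inr ⟨D, hD, rfl⟩)⟩
    by_contra hc
    exact h _ (Or.inl (Or.inl ⟨i, rfl⟩)) ((h1 i).2 hc)
  · rintro ⟨ha, hb, hc⟩ x ((⟨i, rfl⟩ | ⟨D, hD, rfl⟩) | ⟨D, hD, rfl⟩)
    · exact fun h => (h1 i).1 h (ha i)
    · exact hb D hD
    · exact hc D hD

theorem weight_bidegree {n : ℕ} (e : Fin n ⊕ Fin n →₀ ℕ) :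
    Finsupp.weight (Sum.elim (fun _ => ((1, 0) : ℕ × ℕ)) (fun _ => ((0, 1) : ℕ × ℕ))) e =
      (∑ i, e (Sum.inl i), ∑ i, e (Sum.inr i)) := by
  rw [Finsupp.weight_apply, Finsupp.sum_fintype _ _ (by simp), Fintype.sum_sum_type]
  ext <;> simp [Prod.fst_sum, Prod.snd_sum]

/-- One of the exponents of xᵢ and yᵢ is zero, so their difference determines both. -/
theorem ncard_standard_exponents (n N₁ N₂ : ℕ) (d : Fin 2 →₀ ℕ) :
    {e : Fin n ⊕ Fin n →₀ ℕ | Finsupp.weight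
        (Sum.elim (fun _ => ((1, 0) : ℕ × ℕ)) (fun _ => ((0, 1) : ℕ × ℕ))) e = (d 0, d 1) ∧
          ∀ x ∈ hollowExponents n N₁ N₂, ¬ x ≤ e}.ncard =
      {u : Fin n → ℤ | signedWeight u = d ∧ IsBalanced N₁ N₂ u}.ncard := by
  refine Set.ncard_congr (fun e _ i => (e (Sum.inl i) : ℤ) - e (Sum.inr i)) ?_ ?_ ?_
  · rintro e ⟨h1, h2⟩
    rw [not_hollowExponents_le_iff] at h2
    obtain ⟨h2, h3, h4⟩ := h2
    rw [weight_bidegree, Prod.mk.injEq] at h1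
    refine ⟨?_, ?_⟩
    · ext x
      fin_cases x
      · change signedWeight _ 0 = d 0
        rw [signedWeight_zero, ← h1.1]
        exact Finset.sum_congr rfl fun i _ => by have := h2 i; omega
      · change signedWeight _ 1 = d 1
        rw [signedWeight_one, ← h1.2]
        exact Finset.sum_congr rfl fun i _ => by have := h2 i; omega
    · refine ⟨le_of_eq_of_le ?_ h3, le_of_eq_of_le ?_ h4⟩
      · congr 1; ext i
        have := h2 i
        simp only [Finset.mem_filter, Finset.mem_univ, true_and]; omega
      · congr 1; ext i
        have := h2 i
        simp only [Finset.mem_filter, Finset.mem_univ, true_and]; omega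
  · rintro e e' ⟨_, h2⟩ ⟨_, h2'⟩ h
    rw [not_hollowExponents_le_iff] at h2 h2'
    ext x
    rcases x with i | i <;>
    · have a := h2.1 i
      have b := h2'.1 i
      have c := congrFun h i
      omega
  · rintro u ⟨h1, h2⟩
    let e : Fin n ⊕ Fin n →₀ ℕ := Finsupp.equivFunOnFinite.symm
      (Sum.elim (fun i => (u i).toNat) fun i => (-u i).toNat)
    have hl : ∀ i, e (Sum.inl i) = (u i).toNat := fun i => rfl
    have hr : ∀ i, e (Sum.inr i) = (-u i).toNat := fun i => rfl
    refine ⟨e, ⟨?_, ?_⟩, ?_⟩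
    · rw [weight_bidegree, ← h1, signedWeight_zero, signedWeight_one]
      simp only [hl, hr]
    · rw [not_hollowExponents_le_iff]
      simp only [hl, hr]
      refine ⟨fun i => by omega, le_of_eq_of_le ?_ h2.1, le_of_eq_of_le ?_ h2.2⟩
      · congr 1; ext i
        simp only [Finset.mem_filter, Finset.mem_univ, true_and]; omega
      · congr 1; ext i
        simp only [Finset.mem_filter, Finset.mem_univ, true_and]; omega
    · funext i
      rw [hl, hr]; omega

theorem coeff_hilbertSeries_hollowG (γ : HollowParam) (d : Fin 2 →₀ ℕ) :
    MvPowerSeries.coeff d (hilbertSeries (hollowG γ)) =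
      ({u : Fin γ.n → ℤ | signedWeight u = d ∧
        IsBalanced (γ.m₁ + γ.p₁) (γ.m₂ + γ.p₂) u}.ncard : ℚ) := by
  rw [← ncard_standard_exponents, ← finrank_quotientComponent (hollowG_eq_span γ)]
  rfl

end MonomialIdeal

/-! ### Cocharge and the series as a sum over pairs of tableaux -/

section CochargeSeries

namespace StdTableau

variable {μ : YoungDiagram} {n : ℕ}

/-- The cocharge of the number `i + 1`, normalized to vanish at the number `m + 1`. -/
def signedCocharge (T : StdTableau μ n) {m : ℕ} (hm : m < n) (i : Fin n) : ℤ :=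
  (T.cocharge i i.2 : ℤ) - T.cocharge m hm

/-- The column condition is redundant: a number weakly below and weakly left of another is not
larger. -/
theorem cocharge_succ (T : StdTableau μ n) (i : ℕ) (h : i + 1 < n) :
    T.cocharge (i + 1) h = T.cocharge i (by omega) +
      if T.row ⟨i + 1, h⟩ ≤ T.row ⟨i, by omega⟩ then 0 else 1 := by
  rw [cocharge]
  by_cases h1 : T.row ⟨i + 1, h⟩ ≤ T.row ⟨i, by omega⟩
  · have h2 : T.col ⟨i, by omega⟩ ≤ T.col ⟨i + 1, h⟩ := by
      by_contra hc
      have := T.le_of_row_le_col_le h1 (not_le.1 hc).le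
      rw [Fin.mk_le_mk] at this
      omega
    rw [if_pos ⟨h1, h2⟩, if_pos h1, add_zero]
  · rw [if_neg fun h => h1 h.1, if_neg h1]

/-- Normalized cocharge is the compatible sequence whose differences have no excess. -/
theorem signedCocharge_eq_centeredSum {N m : ℕ} (T : StdTableau μ (N + 1)) (hm : m < N + 1) :
    T.signedCocharge hm = centeredSum m (descentStep T.row) := by
  refine eq_of_differences (k := ⟨m, hm⟩) ?_ fun j => ?_
  · rw [centeredSum_self]; simp [signedCocharge]
  · rw [centeredSum_succ]
    have := T.cocharge_succ j.val (by omega)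
    simp only [signedCocharge, Fin.val_succ, Fin.val_castSucc, this]
    simp only [descentStep]
    push_cast
    have e1 : (⟨j.val + 1, by omega⟩ : Fin (N + 1)) = j.succ := rfl
    have e2 : (⟨j.val, by omega⟩ : Fin (N + 1)) = j.castSucc := rfl
    rw [e1, e2]
    ring

theorem isCompatFn_signedCocharge {m : ℕ} (T : StdTableau μ n) (hm : m < n) :
    IsCompatFn T.row (T.signedCocharge hm) := by
  cases n with
  | zero => omega
  | succ N =>
    rw [signedCocharge_eq_centeredSum]
    simpa using isCompatFn_centeredSum m T.row 0

end StdTableau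

theorem constantCoeff_risingProd (x : Fin 2) (j : ℕ) :
    MvPowerSeries.constantCoeff (risingProd (MvPowerSeries.X x) j) = 1 := by
  simp [risingProd, map_prod]

theorem series_eq_of_coeff_eq_ncard {n N₁ N₂ : ℕ} (hn : n = N₁ + N₂ + 1)
    {H : MvPowerSeries (Fin 2) ℚ}
    (hH : ∀ d, MvPowerSeries.coeff d H =
      ({u : Fin n → ℤ | signedWeight u = d ∧ IsBalanced N₁ N₂ u}.ncard : ℚ)) :
    H = (risingProd (MvPowerSeries.X 0) N₁)⁻¹ * (risingProd (MvPowerSeries.X 1) N₂)⁻¹ *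
      ∑ P : TableauPair n, MvPowerSeries.monomial
        (signedWeight (P.2.2.signedCocharge (show N₂ < n by omega))) 1 := by
  subst hn
  have h1 : H = (∑ P : TableauPair (N₁ + N₂ + 1), MvPowerSeries.monomial
        (signedWeight (P.2.2.signedCocharge (show N₂ < N₁ + N₂ + 1 by omega))) 1) *
          solutionSeries (stepWeight N₁ N₂) := by
    ext d
    rw [hH, ncard_isBalanced, Nat.cast_sum, Finset.sum_mul, map_sum]
    refine Finset.sum_congr rfl fun P _ => ?_
    rw [ncard_isCompatFn, StdTableau.signedCocharge_eq_centeredSum]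
  have h2 := solutionSeries_mul_prod (stepWeight_ne_zero N₁ N₂)
  rw [prod_stepWeight] at h2
  have h3 : solutionSeries (stepWeight N₁ N₂) =
      (risingProd (MvPowerSeries.X 0) N₁ * risingProd (MvPowerSeries.X 1) N₂)⁻¹ := by
    rw [MvPowerSeries.eq_inv_iff_mul_eq_one, h2]
    rw [map_mul, constantCoeff_risingProd, constantCoeff_risingProd]
    norm_num
  rw [h1, h3, MvPowerSeries.mul_inv_rev, mul_comm]
  congr 1
  exact mul_comm _ _

end CochargeSeries

/-! ### Distinct pairs of tableaux have distinct bipermanents -/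

namespace StdTableau

variable {μ ν : YoungDiagram} {n : ℕ}

/-- The exponent of the monomial `∏ z_i^{u_i}`. -/
noncomputable def letterExponent (u : Fin n → Alphabet) : Fin n ⊕ Fin n →₀ ℕ :=
  Finsupp.equivFunOnFinite.symm (Sum.elim (fun i => (u i).1.1) fun i => (u i).1.2)

theorem letterExponent_injective :
    Function.Injective (letterExponent : (Fin n → Alphabet) → _) := by
  intro u v h
  funext i
  have h1 := DFunLike.congr_fun h (Sum.inl i)
  have h2 := DFunLike.congr_fun h (Sum.inr i)
  exact Subtype.ext (Prod.ext h1 h2)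

theorem monomial_letterExponent (u : Fin n → Alphabet) :
    monomial (letterExponent u) (1 : ℂ) =
      ∏ i, (X (Sum.inl i) ^ (u i).1.1 * X (Sum.inr i) ^ (u i).1.2) := by
  rw [monomial_eq, C_1, one_mul, Finsupp.prod_fintype _ _ (by simp), Fintype.prod_sum_type,
    ← Finset.prod_mul_distrib]
  rfl

theorem bipermanent_eq_sum_monomial (T : StdTableau μ n) (V : {c // c ∈ μ.cells} → Alphabet) :
    T.bipermanent V = ∑ σ ∈ T.rowGroup,
      monomial (letterExponent fun i => V (T.entry.symm (σ.symm i))) (1 : ℂ) := by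
  refine Finset.sum_congr rfl fun σ _ => ?_
  rw [monomial_letterExponent]
  refine Eq.trans (Finset.prod_congr rfl fun i _ => ?_) (Equiv.prod_comp σ fun i =>
    (X (Sum.inl i) ^ (V (T.entry.symm (σ.symm i))).1.1 *
      X (Sum.inr i) ^ (V (T.entry.symm (σ.symm i))).1.2 : PolyXY n))
  rw [σ.symm_apply_apply]

/-- A permanent has no signs: the coefficient counts permutations, and nothing cancels in
characteristic 0. -/
theorem coeff_bipermanent (T : StdTableau μ n) (V : {c // c ∈ μ.cells} → Alphabet)
    (u : Fin n → Alphabet) : coeff (letterExponent u) (T.bipermanent V) ≠ 0 ↔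
      ∃ σ ∈ T.rowGroup, (fun i => V (T.entry.symm (σ.symm i))) = u := by
  classical
  rw [bipermanent_eq_sum_monomial, coeff_sum]
  simp only [coeff_monomial, letterExponent_injective.eq_iff]
  rw [Finset.sum_boole, Nat.cast_ne_zero, ← Nat.pos_iff_ne_zero, Finset.card_pos]
  simp only [Finset.Nonempty, Finset.mem_filter]

theorem exists_rowGroup_of_bipermanent_eq {T : StdTableau μ n} {T' : StdTableau ν n}
    {V : {c // c ∈ μ.cells} → Alphabet} {V' : {c // c ∈ ν.cells} → Alphabet}
    (h : T.bipermanent V = T'.bipermanent V') {σ : Equiv.Perm (Fin n)} (hσ : σ ∈ T.rowGroup) :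
    ∃ τ ∈ T'.rowGroup, ∀ i, V' (T'.entry.symm (τ.symm i)) = V (T.entry.symm (σ.symm i)) := by
  have h1 := (T.coeff_bipermanent V _).2 ⟨σ, hσ, rfl⟩
  rw [h, coeff_bipermanent] at h1
  obtain ⟨τ, hτ, h2⟩ := h1
  exact ⟨τ, hτ, fun i => congrFun h2 i⟩

theorem mem_rowGroup {T : StdTableau μ n} {σ : Equiv.Perm (Fin n)} :
    σ ∈ T.rowGroup ↔ ∀ i, T.row (σ i) = T.row i := by
  simp [rowGroup]

theorem row_symm_of_mem_rowGroup {T : StdTableau μ n} {σ : Equiv.Perm (Fin n)}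
    (hσ : σ ∈ T.rowGroup) (i : Fin n) : T.row (σ.symm i) = T.row i := by
  rw [← mem_rowGroup.1 hσ (σ.symm i), Equiv.apply_symm_apply]

/-- The letters of `V` increase weakly along rows and strictly along columns. -/
structure IsColumnStrict (V : {c // c ∈ μ.cells} → Alphabet) : Prop where
  row_le : ∀ c d : {c // c ∈ μ.cells}, c.1.1 = d.1.1 → c.1.2 ≤ d.1.2 → V c ≤ V d
  col_lt : ∀ c d : {c // c ∈ μ.cells}, c.1.2 = d.1.2 → c.1.1 < d.1.1 → V c < V d

/-- The number in the first cell of the row of `i`. -/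
def rowHead (T : StdTableau μ n) (i : Fin n) : Fin n :=
  T.entry ⟨(T.row i, 0), (YoungDiagram.mem_cells _).2
    (μ.up_left_mem le_rfl (Nat.zero_le _) (T.mem_row_col i))⟩

theorem row_rowHead (T : StdTableau μ n) (i : Fin n) : T.row (T.rowHead i) = T.row i := by
  simp [rowHead, row]

theorem col_rowHead (T : StdTableau μ n) (i : Fin n) : T.col (T.rowHead i) = 0 := by
  simp [rowHead, col]

theorem rowHead_letter_le {T : StdTableau μ n} {V : {c // c ∈ μ.cells} → Alphabet}
    (hV : IsColumnStrict V) {i j : Fin n} (h : T.row i = T.row j) :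
    V (T.entry.symm (T.rowHead i)) ≤ V (T.entry.symm j) :=
  hV.row_le _ _ ((T.row_rowHead i).trans h)
    (le_of_eq_of_le (T.col_rowHead i) (Nat.zero_le _))

theorem rowHead_letter_lt_iff {T : StdTableau μ n} {V : {c // c ∈ μ.cells} → Alphabet}
    (hV : IsColumnStrict V) {i j : Fin n} :
    V (T.entry.symm (T.rowHead i)) < V (T.entry.symm (T.rowHead j)) ↔ T.row i < T.row j := by
  have key : ∀ i j, T.row i < T.row j →
      V (T.entry.symm (T.rowHead i)) < V (T.entry.symm (T.rowHead j)) := fun i j h =>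
    hV.col_lt _ _ ((T.col_rowHead i).trans (T.col_rowHead j).symm)
      (lt_of_eq_of_lt (T.row_rowHead i) (lt_of_lt_of_eq h (T.row_rowHead j).symm))
  refine ⟨fun h => ?_, key i j⟩
  by_contra hc
  rcases (not_lt.1 hc).eq_or_lt with e | e
  · exact absurd (rowHead_letter_le hV (e.trans (T.row_rowHead i).symm)) (not_le.2 h)
  · exact absurd (key j i e) (not_lt.2 h.le)

/-- The first letter of the row of j is the least letter that any monomial of the bipermanent puts
on the variables of index j. Transposing j with its row head realizes it. So the bipermanent
determines these letters, and by column strictness they order the rows. -/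
theorem rowHead_letter_le_of_bipermanent_eq {T : StdTableau μ n} {T' : StdTableau ν n}
    {V : {c // c ∈ μ.cells} → Alphabet} {V' : {c // c ∈ ν.cells} → Alphabet}
    (hV' : IsColumnStrict V') (h : T.bipermanent V = T'.bipermanent V') (j : Fin n) :
    V' (T'.entry.symm (T'.rowHead j)) ≤ V (T.entry.symm (T.rowHead j)) := by
  have hσ : Equiv.swap j (T.rowHead j) ∈ T.rowGroup := by
    rw [mem_rowGroup]
    intro i
    rcases eq_or_ne i j with rfl | h1
    · rw [Equiv.swap_apply_left, row_rowHead]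
    · rcases eq_or_ne i (T.rowHead j) with rfl | h2
      · rw [Equiv.swap_apply_right, row_rowHead]
      · rw [Equiv.swap_apply_of_ne_of_ne h1 h2]
  obtain ⟨τ, hτ, h2⟩ := exists_rowGroup_of_bipermanent_eq h hσ
  have h3 := h2 j
  rw [Equiv.symm_swap, Equiv.swap_apply_left] at h3
  rw [← h3]
  exact rowHead_letter_le hV' (row_symm_of_mem_rowGroup hτ j).symm

/-- The occupied rows form an initial segment of the naturals, so their order determines their
indices. -/
theorem row_eq_of_lt_iff {T : StdTableau μ n} {T' : StdTableau ν n}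
    (h : ∀ i j, T.row i < T.row j ↔ T'.row i < T'.row j) : T.row = T'.row := by
  have hex : ∀ {κ : YoungDiagram} (S : StdTableau κ n) (j : Fin n) (a : ℕ), a < S.row j →
      ∃ k, S.row k = a := fun S j a ha => by
    obtain ⟨k, hk, _⟩ := S.exists_cell
      (YoungDiagram.up_left_mem _ ha.le le_rfl (S.mem_row_col j))
    exact ⟨k, hk⟩
  have key : ∀ a j, T.row j = a → T'.row j = a := by
    intro a
    induction a using Nat.strong_induction_on with
    | _ a ih =>
      intro j hj
      apply le_antisymm
      · by_contra hc
        obtain ⟨k, hk⟩ := hex T' j a (not_le.1 hc)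
        have h1 : T.row k < T.row j := (h k j).2 (by omega)
        have := ih _ (by omega) k rfl
        omega
      · by_contra hc
        obtain ⟨k, hk⟩ := hex T j (T'.row j) (by omega)
        have h1 := ih _ (by omega) k hk
        have h2 := (h k j).1 (by omega)
        omega
  exact funext fun j => (key _ j rfl).symm

theorem row_eq_of_bipermanent_eq {T : StdTableau μ n} {T' : StdTableau ν n}
    {V : {c // c ∈ μ.cells} → Alphabet} {V' : {c // c ∈ ν.cells} → Alphabet}
    (hV : IsColumnStrict V) (hV' : IsColumnStrict V') (h : T.bipermanent V = T'.bipermanent V') :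
    T.row = T'.row := by
  have e : ∀ j, V' (T'.entry.symm (T'.rowHead j)) = V (T.entry.symm (T.rowHead j)) := fun j =>
    le_antisymm (rowHead_letter_le_of_bipermanent_eq hV' h j)
      (rowHead_letter_le_of_bipermanent_eq hV h.symm j)
  refine row_eq_of_lt_iff fun i j => ?_
  rw [← rowHead_letter_lt_iff hV, ← rowHead_letter_lt_iff hV', e, e]

/-- The monomial of the identity occurs on both sides, so a permutation of cells within rows carries
one filling to the other. -/
theorem map_letter_row_eq {T : StdTableau μ n} {V V' : {c // c ∈ μ.cells} → Alphabet}
    (h : T.bipermanent V = T.bipermanent V') :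
    (Finset.univ.val.map fun c => (V c, c.1.1)) = Finset.univ.val.map fun c => (V' c, c.1.1) := by
  obtain ⟨τ, hτ, h2⟩ := exists_rowGroup_of_bipermanent_eq h
    (σ := Equiv.refl _) (mem_rowGroup.2 fun i => rfl)
  let ρ : {c // c ∈ μ.cells} ≃ {c // c ∈ μ.cells} := (T.entry.trans τ.symm).trans T.entry.symm
  have hρ : Finset.univ.val.map ρ = Finset.univ.val := by
    rw [← Equiv.coe_toEmbedding, ← Finset.map_val, Finset.map_univ_equiv]
  symm
  rw [← hρ, Multiset.map_map, hρ]
  refine Multiset.map_congr rfl fun c _ => ?_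
  have hV : V' (ρ c) = V c := by simpa [ρ] using h2 (T.entry c)
  have hr : (ρ c).1.1 = c.1.1 := by
    simpa [ρ, row] using row_symm_of_mem_rowGroup hτ (T.entry c)
  rw [Function.comp_apply, hV, hr]

/-- The pairs (cocharge, row), read along 1, …, n, are sorted for an antisymmetric relation. Their
multiset therefore gives back the sequence, and with it the rows. -/
theorem eq_of_map_signedCocharge_eq {U U' : StdTableau μ n} {m : ℕ} (hm : m < n)
    (h : (List.ofFn fun i => (U.signedCocharge hm i, U.row i)).Perm
      (List.ofFn fun i => (U'.signedCocharge hm i, U'.row i))) : U = U' := by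
  have hs : ∀ S : StdTableau μ n, (List.ofFn fun i => (S.signedCocharge hm i, S.row i)).Pairwise
      fun p q => p.1 < q.1 ∨ p.1 = q.1 ∧ q.2 ≤ p.2 := fun S =>
    List.pairwise_ofFn.2 (S.isCompatFn_signedCocharge hm)
  have h1 := List.ofFn_injective (h.eq_of_pairwise (by
    rintro ⟨a, b⟩ ⟨c, d⟩ _ _ h1 h2
    simp only [Prod.mk.injEq] at *
    omega) (hs U) (hs U'))
  exact ext_row (funext fun i => congrArg Prod.snd (congrFun h1 i))

end StdTableau

theorem cochargeDiagram_apply (γ : HollowParam) {μ : YoungDiagram} (U : StdTableau μ γ.n)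
    (c : {c // c ∈ μ.cells}) :
    cochargeDiagram γ U c = Alphabet.ofInt (U.signedCocharge
      (show γ.m₂ + γ.p₂ < γ.n by unfold HollowParam.n; omega) (U.entry c)) := rfl

theorem Alphabet.ofInt_le {x y : ℤ} : ofInt x ≤ ofInt y ↔ x ≤ y := by
  change toInt _ ≤ toInt _ ↔ _
  rw [toInt_ofInt, toInt_ofInt]

theorem Alphabet.ofInt_lt {x y : ℤ} : ofInt x < ofInt y ↔ x < y := by
  change toInt _ < toInt _ ↔ _
  rw [toInt_ofInt, toInt_ofInt]

theorem isColumnStrict_cochargeDiagram (γ : HollowParam) {μ : YoungDiagram} (U : StdTableau μ γ.n) :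
    StdTableau.IsColumnStrict (cochargeDiagram γ U) where
  row_le c d h1 h2 := by
    rw [cochargeDiagram_apply, cochargeDiagram_apply, Alphabet.ofInt_le]
    apply (U.isCompatFn_signedCocharge _).monotone
    rcases h2.eq_or_lt with h | h
    · exact (congrArg U.entry (Subtype.ext (Prod.ext h1 h))).le
    · exact (U.row_lt c d h1 h).le
  col_lt c d h1 h2 := by
    rw [cochargeDiagram_apply, cochargeDiagram_apply, Alphabet.ofInt_lt]
    -- Equal letters would force the row to fall weakly, but it rises up a column.
    rcases U.isCompatFn_signedCocharge (show γ.m₂ + γ.p₂ < γ.n by unfold HollowParam.n; omega)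
      (U.col_lt c d h1 h2) with h | h
    · exact h
    · have := h.2
      simp only [StdTableau.row, Equiv.symm_apply_apply] at this
      omega

theorem map_cochargeDiagram_row (γ : HollowParam) {μ : YoungDiagram} (U : StdTableau μ γ.n) :
    ((Finset.univ.val.map fun c => (cochargeDiagram γ U c, c.1.1)).map
      (Prod.map Alphabet.toInt id)) = (List.ofFn fun i => (U.signedCocharge
        (show γ.m₂ + γ.p₂ < γ.n by unfold HollowParam.n; omega) i, U.row i) : Multiset (ℤ × ℕ)) := by
  have hρ : Finset.univ.val.map U.entry = Finset.univ.val := by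
    rw [← Equiv.coe_toEmbedding, ← Finset.map_val, Finset.map_univ_equiv]
  rw [← Fin.univ_val_map, ← hρ, Multiset.map_map, Multiset.map_map]
  refine Multiset.map_congr rfl fun c _ => ?_
  simp [cochargeDiagram_apply, Alphabet.toInt_ofInt, StdTableau.row]

/-- The bipermanent attached to a pair of tableaux. -/
noncomputable def TableauPair.bipermanent (γ : HollowParam) (P : TableauPair γ.n) : PolyXY γ.n :=
  P.2.1.bipermanent (cochargeDiagram γ P.2.2)

theorem TableauPair.bipermanent_injective (γ : HollowParam) :
    Function.Injective (TableauPair.bipermanent γ) := by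
  rintro ⟨μ, T, U⟩ ⟨ν, T', U'⟩ h
  simp only [TableauPair.bipermanent] at h
  have hrow := StdTableau.row_eq_of_bipermanent_eq (isColumnStrict_cochargeDiagram γ U)
    (isColumnStrict_cochargeDiagram γ U') h
  obtain rfl : μ = ν := YoungDiagram.ext_rowLen fun i => by
    rw [← T.prefixCount_row_last, hrow, T'.prefixCount_row_last]
  obtain rfl : T = T' := StdTableau.ext_row hrow
  have hU : U = U' := by
    have h1 := congrArg (Multiset.map (Prod.map Alphabet.toInt id))
      (StdTableau.map_letter_row_eq h)
    rw [map_cochargeDiagram_row, map_cochargeDiagram_row, Multiset.coe_eq_coe] at h1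
    exact StdTableau.eq_of_map_signedCocharge_eq _ h1
  rw [hU]

theorem range_tableauPair_bipermanent (γ : HollowParam) :
    Set.range (TableauPair.bipermanent γ) = hollowB γ := by
  ext b
  constructor
  · rintro ⟨⟨μ, T, U⟩, rfl⟩
    exact ⟨μ, T, _, ⟨U, rfl⟩, rfl⟩
  · rintro ⟨μ, T, _, ⟨U, rfl⟩, rfl⟩
    exact ⟨⟨μ, T, U⟩, rfl⟩

theorem monomial_signedWeight {n : ℕ} (u : Fin n → ℤ) :
    MvPowerSeries.monomial (signedWeight u) (1 : ℚ) =
      MvPowerSeries.X 0 ^ (∑ i, (u i).toNat) * MvPowerSeries.X 1 ^ (∑ i, (-u i).toNat) := by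
  rw [MvPowerSeries.X_pow_eq, MvPowerSeries.X_pow_eq, MvPowerSeries.monomial_mul_monomial, mul_one]
  rfl

theorem X_pow_degrees_bipermanent (γ : HollowParam) (P : TableauPair γ.n) :
    (MvPowerSeries.X 0 : MvPowerSeries (Fin 2) ℚ) ^ xDeg (P.bipermanent γ) *
        (MvPowerSeries.X 1 : MvPowerSeries (Fin 2) ℚ) ^ yDeg (P.bipermanent γ) =
      MvPowerSeries.monomial (signedWeight (P.2.2.signedCocharge
        (show γ.m₂ + γ.p₂ < γ.n by unfold HollowParam.n; omega))) 1 := by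
  rw [monomial_signedWeight, TableauPair.bipermanent, xDeg_bipermanent, yDeg_bipermanent,
    ← Equiv.sum_comp P.2.2.entry, ← Equiv.sum_comp P.2.2.entry]
  rfl

theorem mainTheorem9 (γ : HollowParam) :
    hilbertSeries (hollowG γ) =
      (risingProd (MvPowerSeries.X 0) (γ.m₁ + γ.p₁))⁻¹ *
        (risingProd (MvPowerSeries.X 1) (γ.m₂ + γ.p₂))⁻¹ *
        ∑ b ∈ (hollowB_finite γ).toFinset,
          (MvPowerSeries.X 0 : MvPowerSeries (Fin 2) ℚ) ^ xDeg b *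
            (MvPowerSeries.X 1 : MvPowerSeries (Fin 2) ℚ) ^ yDeg b := by
  classical
  have hB : (hollowB_finite γ).toFinset = Finset.univ.image (TableauPair.bipermanent γ) := by
    ext b
    rw [Set.Finite.mem_toFinset, ← range_tableauPair_bipermanent]
    simp
  rw [hB, Finset.sum_image (TableauPair.bipermanent_injective γ).injOn,
    Finset.sum_congr rfl fun P _ => X_pow_degrees_bipermanent γ P]
  exact series_eq_of_coeff_eq_ncard (by unfold HollowParam.n; omega)
    (coeff_hilbertSeries_hollowG γ)
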